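/- Let $R=\mathbb{K}[x_1,\dots,x_n]$ over a field $\mathbb{K}$ with a fixed monomial order, let $f_1,\dots,f_r\in R$, and put $I_i=\langle f_1,\dots,f_i\rangle$. Write $\operatorname{lm}$, $\operatorname{lt}$ for the leading monomial and leading term of a nonzero polynomial. A \emph{signature} is a pair $(i,u)$ with $1\le i\le r$ and $u$ a monomial; signatures are ordered by index first and then by the monomial order, $a(i,u)=(i,au)$, and $\sigma$ divides $\tau$ if $\tau=a\sigma$ for a monomial $a$. An \emph{extended sig-poly pair} is a triple $\alpha=(\operatorname{poly}(\alpha),\mathfrak{s}(\alpha),\operatorname{quo}(\alpha))$ of a polynomial, a signature with index $\operatorname{ind}(\alpha)$ and a polynomial, such that $\operatorname{lm}(\operatorname{quo}(\alpha))$ is the monomial of $\mathfrak{s}(\alpha)$ and $\operatorname{poly}(\alpha)-\operatorname{quo}(\alpha)f_{\operatorname{ind}(\alpha)}\in I_{\operatorname{ind}(\alpha)-1}$. For $\alpha,\beta$ with nonzero polynomial parts let $c=\operatorname{lcm}(\operatorname{lm}(\operatorname{poly}(\alpha)),\operatorname{lm}(\operatorname{poly}(\beta)))$, $a=c/\operatorname{lt}(\operatorname{poly}(\alpha))$,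 $b=c/\operatorname{lt}(\operatorname{poly}(\beta))$ (in products with signatures, coefficients are ignored). They form a \emph{regular S-pair} if $\mathfrak{s}(a\alpha)\ne\mathfrak{s}(b\beta)$. Ordered so that $\mathfrak{s}(\alpha)\ge\mathfrak{s}(\beta)$, their S-pair has polynomial part $a\operatorname{poly}(\alpha)-b\operatorname{poly}(\beta)$, signature $\max(a\,\mathfrak{s}(\alpha),b\,\mathfrak{s}(\beta))$, and quotient $a\operatorname{quo}(\alpha)$ if $\operatorname{ind}(\alpha)>\operatorname{ind}(\beta)$ and $a\operatorname{quo}(\alpha)-b\operatorname{quo}(\beta)$ if the indices are equal. \emph{Regular reduction} of $\gamma$ by $G$: as long as $\operatorname{poly}(\gamma)\neq0$ and there is $\beta\in G$ with $\operatorname{poly}(\beta)\ne0$, $\operatorname{lm}(\operatorname{poly}(\beta))\mid\operatorname{lm}(\operatorname{poly}(\gamma))$ and $b\,\mathfrak{s}(\beta)<\mathfrak{s}(\gamma)$, where $b=\operatorname{lt}(\operatorname{poly}(\gamma))/\operatorname{lt}(\operatorname{poly}(\beta))$, choose such a $\beta$, replace $\operatorname{poly}(\gamma)$ by $\operatorname{poly}(\gamma)-b\operatorname{poly}(\beta)$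 and, if $\operatorname{ind}(\beta)=\operatorname{ind}(\gamma)$, replace $\operatorname{quo}(\gamma)$ by $\operatorname{quo}(\gamma)-b\operatorname{quo}(\beta)$; the signature is kept. For $\alpha\in G$ and a monomial $a$, the multiple $a\alpha$ is \emph{rewritable} if some $\delta\in G$ satisfies one of: $\mathfrak{s}(\delta)$ divides $a\,\mathfrak{s}(\alpha)$ and $\delta$ was added to $G$ later than $\alpha$ (singular criterion); $\mathfrak{s}(\delta)$ divides $a\,\mathfrak{s}(\alpha)$ and $\operatorname{poly}(\delta)=0$ (syzygy criterion); $\operatorname{ind}(\delta)<\operatorname{ind}(\alpha)$, $\operatorname{poly}(\delta)\neq0$ and $\operatorname{lm}(\operatorname{poly}(\delta))$ divides $\operatorname{lm}(a\operatorname{quo}(\alpha))$ (Koszul criterion). The \emph{algorithm}: start with $G=\{(f_i,(i,1),1): 1\le i\le r\}$, $S_1=\dots=S_r=\varnothing$, and $P$ the set of all regular S-pairs of elements of $G$. While $P\ne\varnothing$: remove from $P$ a pair $(\alpha,\beta)$ whose S-pair has minimal signature. If one of $a\alpha$, $b\beta$ ($a,b$ the monomials of the S-pair) is rewritable, discard the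 pair. Otherwise let $\gamma$ be a regular reduction of its S-pair by $G$ and add $\gamma$ to $G$; if $\operatorname{poly}(\gamma)\ne0$, add to $P$ all regular S-pairs of $\gamma$ with elements of $G$; if $\operatorname{poly}(\gamma)=0$, insert $\operatorname{quo}(\gamma)$ into $S_{\operatorname{ind}(\gamma)}$. When $P=\varnothing$, return $\{\operatorname{poly}(\beta):\beta\in G\}$ and $S_1,\dots,S_r$. \textbf{Theorem.} On every input $f_1,\dots,f_r\in R$ the algorithm terminates, whatever choices are made (among the pairs of minimal signature and among the reducers), and for every run: (i) the returned set $\{\operatorname{poly}(\beta):\beta\in G\}$ is a Gröbner basis of $\langle f_1,\dots,f_r\rangle$; (ii) $I_{i-1}+\langle S_i\rangle=I_{i-1}:f_i$ for every $i$ with $f_i\neq 0$. Moreover, whenever a polynomial $g$ is inserted into some $S_i$ in the course of a run, $g\neq0$ and $\operatorname{lm}(g)$ is not divisible by the leading monomial of any nonzero element of $I_{i-1}$ or of any element previously inserted into $S_i$. -/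

import Mathlib

open scoped MonomialOrder

namespace SGB

noncomputable section

/-- A signature `(i, u)`: an index and (the exponent of) a monomial. -/
abbrev Signature (n r : ℕ) : Type := Fin r × (Fin n →₀ ℕ)

namespace Signature

variable {n r : ℕ}

/-- Index first, then the monomial order. -/
def lt (m : MonomialOrder (Fin n)) (s t : Signature n r) : Prop :=
  s.1 < t.1 ∨ (s.1 = t.1 ∧ s.2 ≺[m] t.2)

/-- The product of a monomial and a signature. -/
def mul (a : Fin n →₀ ℕ) (s : Signature n r) : Signature n r := (s.1, a + s.2)

def divides (s t : Signature n r) : Prop := ∃ a : Fin n →₀ ℕ, mul a s = t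

open Classical in
/-- The larger one of two signatures. -/
def max (m : MonomialOrder (Fin n)) (s t : Signature n r) : Signature n r :=
  if lt m s t then t else s

end Signature

/-- The data of an extended sig-poly pair `(poly, sig, quo)`. The algorithm below starts from
triples with `lm(quo) = sig.2` and `poly - quo * f_i ∈ ⟨f_j : j < i⟩`, `i = sig.1`, and its
operations preserve these two properties. -/
structure SigPoly (K : Type*) [Field K] (n r : ℕ) where
  poly : MvPolynomial (Fin n) K
  sig : Signature n r
  quo : MvPolynomial (Fin n) K

variable {K : Type*} [Field K] {n r : ℕ}

namespace SigPoly

/-- The index of a sig-poly pair. -/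
abbrev ind (α : SigPoly K n r) : Fin r := α.sig.1

end SigPoly

/-- The exponent of `lcm(lm(p), lm(q)) / lm(p)`. -/
def cofactor (m : MonomialOrder (Fin n)) (p q : MvPolynomial (Fin n) K) : Fin n →₀ ℕ :=
  (m.degree p ⊔ m.degree q) - m.degree p

/-- The term `lcm(lm(p), lm(q)) / lt(p)`. -/
def cofactorTerm (m : MonomialOrder (Fin n)) (p q : MvPolynomial (Fin n) K) :
    MvPolynomial (Fin n) K :=
  MvPolynomial.monomial (cofactor m p q) (m.leadingCoeff p)⁻¹

/-- `α` and `β` form a regular S-pair. -/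
def IsRegularPair (m : MonomialOrder (Fin n)) (α β : SigPoly K n r) : Prop :=
  α.poly ≠ 0 ∧ β.poly ≠ 0 ∧
    Signature.mul (cofactor m α.poly β.poly) α.sig ≠
      Signature.mul (cofactor m β.poly α.poly) β.sig

/-- The S-pair of `α` and `β`, where the signature of `α` is at least that of `β`. -/
def sPairOrdered (m : MonomialOrder (Fin n)) (α β : SigPoly K n r) : SigPoly K n r where
  poly := cofactorTerm m α.poly β.poly * α.poly - cofactorTerm m β.poly α.poly * β.poly
  sig := Signature.max m (Signature.mul (cofactor m α.poly β.poly) α.sig)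
    (Signature.mul (cofactor m β.poly α.poly) β.sig)
  quo := if β.ind < α.ind then cofactorTerm m α.poly β.poly * α.quo
    else cofactorTerm m α.poly β.poly * α.quo - cofactorTerm m β.poly α.poly * β.quo

open Classical in
/-- The S-pair of `α` and `β`, the one with the larger signature being put first. -/
def sPair (m : MonomialOrder (Fin n)) (α β : SigPoly K n r) : SigPoly K n r :=
  if Signature.lt m α.sig β.sig then sPairOrdered m β α else sPairOrdered m α β

/-- The term `lt(p) / lt(q)`, for `lm(q) ∣ lm(p)`. -/
def ltQuot (m : MonomialOrder (Fin n)) (p q : MvPolynomial (Fin n) K) : MvPolynomial (Fin n) K :=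
  MvPolynomial.monomial (m.degree p - m.degree q) (m.leadingCoeff p / m.leadingCoeff q)

/-- One pass through the loop of regular reduction: the leading term of `γ` is cancelled by a
multiple of an element of `G`, this multiple having a smaller signature than `γ`. -/
def RegRedStep (m : MonomialOrder (Fin n)) (G : List (SigPoly K n r)) (γ γ' : SigPoly K n r) :
    Prop :=
  ∃ β ∈ G, γ.poly ≠ 0 ∧ β.poly ≠ 0 ∧ m.degree β.poly ≤ m.degree γ.poly ∧
    Signature.lt m (Signature.mul (m.degree γ.poly - m.degree β.poly) β.sig) γ.sig ∧
    γ'.poly = γ.poly - ltQuot m γ.poly β.poly * β.poly ∧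
    γ'.sig = γ.sig ∧
    (β.ind = γ.ind → γ'.quo = γ.quo - ltQuot m γ.poly β.poly * β.quo) ∧
    (β.ind ≠ γ.ind → γ'.quo = γ.quo)

/-- The rewritability check for `a α`, where `α` is the entry at position `k` of the list `G`, in
which the elements stand in the order in which they were added. The three alternatives are the
singular, the syzygy and the Koszul criterion. -/
def Rewritable (m : MonomialOrder (Fin n)) (G : List (SigPoly K n r)) (k : ℕ)
    (α : SigPoly K n r) (a : Fin n →₀ ℕ) : Prop :=
  ∃ (j : ℕ) (δ : SigPoly K n r), G[j]? = some δ ∧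
    ((Signature.divides δ.sig (Signature.mul a α.sig) ∧ k < j) ∨
     (Signature.divides δ.sig (Signature.mul a α.sig) ∧ δ.poly = 0) ∨
     (δ.ind < α.ind ∧ δ.poly ≠ 0 ∧
        m.degree δ.poly ≤ m.degree (MvPolynomial.monomial a (1 : K) * α.quo)))

/-- The variables of the algorithm: the list `G` of sig-poly pairs in the order of their insertion,
the set `P` of S-pairs that wait, each given by the positions of its two members in `G` (the larger
position first), and the sets `S i` of recorded quotients. -/
structure Vars (K : Type*) [Field K] (n r : ℕ) where
  G : List (SigPoly K n r)
  P : Set (ℕ × ℕ)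
  S : Fin r → Set (MvPolynomial (Fin n) K)

/-- The positions `(k, l)`, `l < k`, in `G` of the regular S-pairs. -/
def regularPairs (m : MonomialOrder (Fin n)) (G : List (SigPoly K n r)) : Set (ℕ × ℕ) :=
  {p | p.2 < p.1 ∧ ∃ α β, G[p.1]? = some α ∧ G[p.2]? = some β ∧ IsRegularPair m α β}

/-- A state of the algorithm: it is at the head of the main loop, or it is inside the regular
reduction of an S-pair, of which `γ` is the current remainder. -/
inductive State (K : Type*) [Field K] (n r : ℕ) where
  | main (v : Vars K n r) : State K n r
  | reducing (v : Vars K n r) (γ : SigPoly K n r) : State K n r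

/-- The sig-poly pairs `(f_i, (i, 1), 1)`. -/
def initG (f : Fin r → MvPolynomial (Fin n) K) : List (SigPoly K n r) :=
  List.ofFn fun i => { poly := f i, sig := (i, 0), quo := 1 }

/-- The state in which the algorithm enters its main loop. -/
def init (m : MonomialOrder (Fin n)) (f : Fin r → MvPolynomial (Fin n) K) : State K n r :=
  State.main { G := initG f, P := regularPairs m (initG f), S := fun _ => ∅ }

/-- `(α, β)`, at the positions `(k, l)`, is a pair in `P` whose S-pair has minimal signature. -/
def IsMinimalPair (m : MonomialOrder (Fin n)) (v : Vars K n r) (k l : ℕ)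
    (α β : SigPoly K n r) : Prop :=
  (k, l) ∈ v.P ∧ v.G[k]? = some α ∧ v.G[l]? = some β ∧
    ∀ (k' l' : ℕ) (α' β' : SigPoly K n r), (k', l') ∈ v.P →
      v.G[k']? = some α' → v.G[l']? = some β' →
        ¬ Signature.lt m (sPair m α' β').sig (sPair m α β).sig

/-- One of the two multiples that make up the S-pair of `α` and `β` is rewritable. -/
def PairRewritable (m : MonomialOrder (Fin n)) (v : Vars K n r) (k l : ℕ)
    (α β : SigPoly K n r) : Prop :=
  Rewritable m v.G k α (cofactor m α.poly β.poly) ∨ Rewritable m v.G l β (cofactor m β.poly α.poly)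

/-- The steps of the algorithm. Where the algorithm leaves a choice (among the pairs of minimal
signature, among the reducers), every choice gives a step. -/
inductive Step (m : MonomialOrder (Fin n)) : State K n r → State K n r → Prop
  /-- A pair of minimal signature is removed from `P` and discarded. -/
  | discard (v : Vars K n r) (k l : ℕ) (α β : SigPoly K n r)
      (hmin : IsMinimalPair m v k l α β) (hrw : PairRewritable m v k l α β) :
      Step m (State.main v) (State.main { v with P := v.P \ {(k, l)} })
  /-- A pair of minimal signature is removed from `P` and its regular reduction begins. -/
  | select (v : Vars K n r) (k l : ℕ) (α β : SigPoly K n r)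
      (hmin : IsMinimalPair m v k l α β) (hrw : ¬ PairRewritable m v k l α β) :
      Step m (State.main v) (State.reducing { v with P := v.P \ {(k, l)} } (sPair m α β))
  /-- A step of the regular reduction. -/
  | reduce (v : Vars K n r) (γ γ' : SigPoly K n r) (h : RegRedStep m v.G γ γ') :
      Step m (State.reducing v γ) (State.reducing v γ')
  /-- The regular reduction has ended with a nonzero polynomial part: `γ` is added to `G` and its
  regular S-pairs with the elements of `G` are added to `P`. -/
  | insert (v : Vars K n r) (γ : SigPoly K n r) (hirr : ∀ γ', ¬ RegRedStep m v.G γ γ')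
      (hγ : γ.poly ≠ 0) :
      Step m (State.reducing v γ)
        (State.main
          { G := v.G ++ [γ]
            P := v.P ∪ {p | p ∈ regularPairs m (v.G ++ [γ]) ∧ p.1 = v.G.length}
            S := v.S })
  /-- The regular reduction has ended with zero: `γ` is added to `G` and its quotient is recorded. -/
  | record (v : Vars K n r) (γ : SigPoly K n r) (hγ : γ.poly = 0) :
      Step m (State.reducing v γ)
        (State.main
          { G := v.G ++ [γ]
            P := v.P
            S := Function.update v.S γ.ind (v.S γ.ind ∪ {γ.quo}) })

/-- The state `s` occurs in some run of the algorithm on the input `f`. -/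
def Reachable (m : MonomialOrder (Fin n)) (f : Fin r → MvPolynomial (Fin n) K)
    (s : State K n r) : Prop :=
  Relation.ReflTransGen (Step m) (init m f) s

/-- The set of the polynomial parts of the elements of `G`. -/
def polys (G : List (SigPoly K n r)) : Set (MvPolynomial (Fin n) K) :=
  {p | ∃ α ∈ G, α.poly = p}

/-- The ideal generated by the leading monomials of the nonzero elements of `A`. -/
def leadIdeal (m : MonomialOrder (Fin n)) (A : Set (MvPolynomial (Fin n) K)) :
    Ideal (MvPolynomial (Fin n) K) :=
  Ideal.span {t | ∃ p ∈ A, p ≠ 0 ∧ t = MvPolynomial.monomial (m.degree p) (1 : K)}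

/-- `B` is a Gröbner basis of the ideal `I`. -/
def IsGroebnerBasis (m : MonomialOrder (Fin n)) (I : Ideal (MvPolynomial (Fin n) K))
    (B : Set (MvPolynomial (Fin n) K)) : Prop :=
  B.Finite ∧ B ⊆ I ∧ leadIdeal m B = leadIdeal m (I : Set (MvPolynomial (Fin n) K))

/-- The ideal `⟨f_j : j < i⟩`. -/
def idealBelow (f : Fin r → MvPolynomial (Fin n) K) (i : Fin r) :
    Ideal (MvPolynomial (Fin n) K) :=
  Ideal.span {p | ∃ j, j < i ∧ f j = p}

end

end SGB

/-! A polynomial `p` has signature `(i, u)` if `p ≡ q f_i` modulo `I_{i-1}` for some `q` with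
leading monomial `u`. Two polynomials of one signature differ, after scaling, by something of
smaller signature. So if the leading monomial of `p` occurs at no smaller signature, it is the least
one at its own signature, and zero does not have that signature (`HasSig.degree_le_of_not_sigLM`).

Correctness rests on `IsComplete.syzWitness_or_not_sigLM`. Given `τ`, let `α` be the last element of
`G` whose signature divides `τ`, and let `a α` have signature `τ`. Either a criterion exposes `τ` as
a syzygy signature, or `lm(a α)` occurs at no smaller signature. If it did occur, first at `ρ < τ`,
induction at `ρ` would give a multiple `b β` with the same leading monomial. The S-pair of `α` and
`β` has been treated: a later element with its signature contradicts the choice of `α`, a rewritable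
multiple of `β` makes `ρ` a syzygy signature, which it is not, and a rewritable multiple of `α`
exposes `τ`. Since pairs are chosen by minimal signature, this already holds below the current
signature during the run, so a finished regular reduction has zero or a leading monomial that is new
at its signature. At the end it holds everywhere, which gives the Gröbner basis and the colon
ideals.

For termination, an infinite run would make `G` infinite. Elements with zero polynomial part are
finitely many by Dickson's lemma and the syzygy criterion. For the others, consider the ratio of the
leading monomial to the monomial of the signature. Only finitely many ratios occur, each added
element has a parent of larger ratio, and a parent has finitely many children (`finite_of_ratio`).
-/

namespace SGB

/-! ### The order and divisibility of signatures. -/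

namespace Signature

variable {n r : ℕ} {m : MonomialOrder (Fin n)} {s t u : Signature n r} {a b : Fin n →₀ ℕ}

/-- A signature as an element of the lexicographic product of the indices and the monomials. -/
noncomputable def key (m : MonomialOrder (Fin n)) (s : Signature n r) : Fin r ×ₗ m.syn :=
  toLex (s.1, m.toSyn s.2)

lemma lt_iff_key : lt m s t ↔ key m s < key m t := by
  simp [lt, key, Prod.Lex.toLex_lt_toLex]

lemma key_injective : Function.Injective (key m : Signature n r → _) := by
  rintro ⟨i, u⟩ ⟨j, v⟩ h
  simpa [key] using h

lemma not_lt_self : ¬ lt m s s := by simp [lt_iff_key]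

lemma lt.trans (h : lt m s t) (h' : lt m t u) : lt m s u := by
  rw [lt_iff_key] at *
  exact h.trans h'

lemma lt_trichotomy : lt m s t ∨ s = t ∨ lt m t s := by
  rw [lt_iff_key, lt_iff_key, ← key_injective.eq_iff (a := s) (b := t) (f := key m)]
  exact _root_.lt_trichotomy _ _

lemma lt_of_not_lt_of_lt (h : ¬ lt m t s) (h' : lt m t u) : lt m s u := by
  rw [lt_iff_key] at *
  exact (not_lt.1 h).trans_lt h'

lemma wellFounded_lt : WellFounded (lt m : Signature n r → Signature n r → Prop) := by
  have : (lt m : Signature n r → Signature n r → Prop) = InvImage (· < ·) (key m) := by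
    ext s t
    exact lt_iff_key
  rw [this]
  exact InvImage.wf _ _root_.wellFounded_lt

@[simp] lemma mul_fst : (mul a s).1 = s.1 := rfl

@[simp] lemma mul_snd : (mul a s).2 = a + s.2 := rfl

lemma mul_mul : mul a (mul b s) = mul (a + b) s := by simp [mul, add_assoc]

lemma mul_lt_mul : lt m (mul a s) (mul a t) ↔ lt m s t := by simp [lt, mul]

lemma divides.trans (h : divides s t) (h' : divides t u) : divides s u := by
  obtain ⟨a, rfl⟩ := h
  obtain ⟨b, rfl⟩ := h'
  exact ⟨b + a, mul_mul.symm⟩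

lemma divides_iff : divides s t ↔ s.1 = t.1 ∧ s.2 ≤ t.2 := by
  constructor
  · rintro ⟨a, rfl⟩
    simp
  · rintro ⟨h, h'⟩
    exact ⟨t.2 - s.2, Prod.ext h (tsub_add_cancel_of_le h')⟩

lemma divides.not_lt (h : divides s t) : ¬ lt m t s := by
  obtain ⟨h1, h2⟩ := divides_iff.1 h
  rintro (h | ⟨-, h⟩)
  · exact h.ne h1.symm
  · exact (m.toSyn_monotone h2).not_gt h

lemma max_of_lt (h : lt m s t) : max m s t = t := if_pos h

lemma max_of_lt' (h : lt m t s) : max m s t = s := if_neg fun h' => not_lt_self (h.trans h')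

end Signature

/-! ### Representations of polynomials and their signatures. -/

variable {K : Type*} [Field K] {n r : ℕ} {m : MonomialOrder (Fin n)}
  {f : Fin r → MvPolynomial (Fin n) K} {p p' q q' : MvPolynomial (Fin n) K}
  {σ τ ρ : Signature n r} {a e : Fin n →₀ ℕ} {c : K}

open MvPolynomial

lemma mem_idealBelow {i j : Fin r} (h : j < i) : f j ∈ idealBelow f i :=
  Ideal.subset_span ⟨j, h, rfl⟩

lemma idealBelow_mono {i j : Fin r} (h : i ≤ j) : idealBelow f i ≤ idealBelow f j :=
  Ideal.span_mono fun _ ⟨k, hk, hp⟩ => ⟨k, hk.trans_le h, hp⟩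

lemma degree_monomial_mul (hc : c ≠ 0) (hp : p ≠ 0) :
    m.degree (monomial a c * p) = a + m.degree p := by
  classical
  rw [m.degree_mul (by simpa using hc) hp, m.degree_monomial, if_neg hc]

lemma degree_sub_C_mul_lt (hq : q ≠ 0) (h : m.degree p = m.degree q) :
    p - C (m.leadingCoeff p / m.leadingCoeff q) * q = 0 ∨
      m.degree (p - C (m.leadingCoeff p / m.leadingCoeff q) * q) ≺[m] m.degree p := by
  set g := p - C (m.leadingCoeff p / m.leadingCoeff q) * q with hg
  have hlc : m.leadingCoeff q ≠ 0 := by simpa using hq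
  by_cases hg0 : g = 0
  · exact .inl hg0
  refine .inr (lt_of_le_of_ne ?_ fun he => ?_)
  · refine m.degree_sub_le.trans (sup_le le_rfl ?_)
    refine m.degree_mul_le.trans ?_
    simp [h]
  · have he : m.degree g = m.degree p := m.toSyn.injective he
    have h1 : g.coeff (m.degree g) = 0 := by
      rw [he, hg, coeff_sub, coeff_C_mul, h]
      change coeff (m.degree q) p - _ * m.leadingCoeff q = 0
      rw [← h]
      change m.leadingCoeff p - _ = 0
      field_simp
      ring
    exact hg0 (m.coeff_degree_eq_zero_iff.1 h1)

/-- `p` is congruent to `q * f_i` modulo `⟨f_j : j < i⟩`, and `(i, lm(q)) = τ`. -/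
def Rep (m : MonomialOrder (Fin n)) (f : Fin r → MvPolynomial (Fin n) K) (τ : Signature n r)
    (p q : MvPolynomial (Fin n) K) : Prop :=
  q ≠ 0 ∧ m.degree q = τ.2 ∧ p - q * f τ.1 ∈ idealBelow f τ.1

/-- `p` has a representation of signature `τ`. -/
def HasSig (m : MonomialOrder (Fin n)) (f : Fin r → MvPolynomial (Fin n) K) (τ : Signature n r)
    (p : MvPolynomial (Fin n) K) : Prop :=
  ∃ q, Rep m f τ p q

/-- `p` has a representation of signature less than `τ`. -/
def SigLT (m : MonomialOrder (Fin n)) (f : Fin r → MvPolynomial (Fin n) K) (τ : Signature n r)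
    (p : MvPolynomial (Fin n) K) : Prop :=
  ∃ q, (q = 0 ∨ m.degree q ≺[m] τ.2) ∧ p - q * f τ.1 ∈ idealBelow f τ.1

/-- `e` is the leading exponent of a polynomial with a representation of signature less than
`τ`. -/
def SigLM (m : MonomialOrder (Fin n)) (f : Fin r → MvPolynomial (Fin n) K) (τ : Signature n r)
    (e : Fin n →₀ ℕ) : Prop :=
  ∃ p, SigLT m f τ p ∧ p ≠ 0 ∧ m.degree p = e

lemma Rep.neg (h : Rep m f τ p q) : Rep m f τ (-p) (-q) := by
  obtain ⟨h0, h1, h2⟩ := h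
  refine ⟨neg_ne_zero.2 h0, by rw [m.degree_neg, h1], ?_⟩
  convert neg_mem h2 using 1
  ring

lemma Rep.monomial_mul (hc : c ≠ 0) (h : Rep m f τ p q) :
    Rep m f (Signature.mul a τ) (monomial a c * p) (monomial a c * q) := by
  obtain ⟨h0, h1, h2⟩ := h
  refine ⟨mul_ne_zero (by simpa using hc) h0, by simp [degree_monomial_mul hc h0, h1], ?_⟩
  change monomial a c * p - monomial a c * q * f τ.1 ∈ idealBelow f τ.1
  convert Ideal.mul_mem_left _ (monomial a c) h2 using 1
  ring

lemma Rep.mem_idealBelow {i : Fin r} (h : Rep m f τ p q) (hi : τ.1 < i) : p ∈ idealBelow f i := by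
  have := add_mem (idealBelow_mono hi.le h.2.2)
    (Ideal.mul_mem_left _ q (SGB.mem_idealBelow (f := f) hi))
  simpa using this

lemma Rep.mem_span (h : Rep m f τ p q) : p ∈ Ideal.span (Set.range f) := by
  have h1 : idealBelow f τ.1 ≤ Ideal.span (Set.range f) :=
    Ideal.span_mono fun _ ⟨k, _, hp⟩ => ⟨k, hp⟩
  have := add_mem (h1 h.2.2) (Ideal.mul_mem_left _ q (Ideal.subset_span ⟨τ.1, rfl⟩))
  simpa using this

lemma degree_sub_of_sigLT (h0 : q ≠ 0) (h1 : m.degree q = e) (h : q' = 0 ∨ m.degree q' ≺[m] e) :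
    q - q' ≠ 0 ∧ m.degree (q - q') = e := by
  rcases h with rfl | h
  · simp [h0, h1]
  · refine ⟨fun h2 => ?_, by rw [m.degree_sub_of_lt (by rwa [h1]), h1]⟩
    rw [sub_eq_zero.1 h2] at h1
    exact h.ne (by rw [h1])

lemma Rep.sub_of_eq (h : Rep m f τ p q) (h' : Rep m f ρ p' q') (hlt : Signature.lt m ρ τ)
    (hi : ρ.1 = τ.1) : Rep m f τ (p - p') (q - q') := by
  have hlt' : m.degree q' ≺[m] τ.2 := by
    rcases hlt with h1 | ⟨-, h1⟩
    · exact absurd hi h1.ne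
    · rwa [h'.2.1]
  obtain ⟨h1, h2⟩ := degree_sub_of_sigLT h.1 h.2.1 (.inr hlt')
  refine ⟨h1, h2, ?_⟩
  have h3 := h'.2.2
  rw [hi] at h3
  convert sub_mem h.2.2 h3 using 1
  ring

/-- A polynomial of smaller index lies in the ideal that is divided out; this is why the algorithm
leaves the quotient alone in this case. -/
lemma Rep.sub_of_lt (h : Rep m f τ p q) (h' : Rep m f ρ p' q') (hi : ρ.1 < τ.1) :
    Rep m f τ (p - p') q := by
  refine ⟨h.1, h.2.1, ?_⟩
  convert sub_mem h.2.2 (h'.mem_idealBelow hi) using 1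
  ring

lemma HasSig.monomial_mul (hc : c ≠ 0) (h : HasSig m f τ p) :
    HasSig m f (Signature.mul a τ) (monomial a c * p) :=
  let ⟨_, hq⟩ := h
  ⟨_, hq.monomial_mul hc⟩

lemma HasSig.sigLT (h : HasSig m f ρ p) (hlt : Signature.lt m ρ τ) : SigLT m f τ p := by
  obtain ⟨q, hq⟩ := h
  rcases hlt with hlt | ⟨h1, h2⟩
  · exact ⟨0, .inl rfl, by simpa using hq.mem_idealBelow hlt⟩
  · exact ⟨q, .inr (by rwa [hq.2.1]), h1 ▸ hq.2.2⟩

/-- The constant is chosen to cancel the leading terms of the quotients, not those of the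
polynomials. -/
lemma HasSig.sub (h : HasSig m f τ p) (h' : HasSig m f τ p') :
    ∃ c : K, c ≠ 0 ∧ SigLT m f τ (p - C c * p') := by
  obtain ⟨q, hq0, hq, hp⟩ := h
  obtain ⟨q', hq0', hq', hp'⟩ := h'
  refine ⟨m.leadingCoeff q / m.leadingCoeff q', by simp [hq0, hq0'],
    q - C (m.leadingCoeff q / m.leadingCoeff q') * q', ?_, ?_⟩
  · have := degree_sub_C_mul_lt (m := m) hq0' (hq.trans hq'.symm)
    rwa [hq] at this
  · convert sub_mem hp (Ideal.mul_mem_left _ (C (m.leadingCoeff q / m.leadingCoeff q')) hp') using 1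
    ring

/-- A polynomial of signature `τ` whose leading monomial does not occur below `τ` has the least
leading monomial among the polynomials of signature `τ`, and none of these is zero. -/
lemma HasSig.degree_le_of_not_sigLM (h : HasSig m f τ p) (h0 : p ≠ 0)
    (hlm : ¬ SigLM m f τ (m.degree p)) (h' : HasSig m f τ p') :
    p' ≠ 0 ∧ m.degree p ≼[m] m.degree p' := by
  obtain ⟨c, hc, hlt⟩ := h.sub h'
  have hp' : p' ≠ 0 := by
    rintro rfl
    exact hlm ⟨p, by simpa using hlt, h0, rfl⟩
  refine ⟨hp', not_lt.1 fun hd => ?_⟩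
  -- If `p'` had the smaller leading monomial, `p - c p'` would keep that of `p` while having a
  -- smaller signature.
  have h1 := degree_sub_of_sigLT (m := m) (q' := C c * p') h0 rfl (.inr (by
    rw [C_apply, degree_monomial_mul hc hp']
    simpa using hd))
  exact hlm ⟨_, hlt, h1⟩

/-- The last generator with a nonzero coefficient gives the signature. The bound is a natural
number, possibly beyond `r`, so that induction covers both `idealBelow` and the full ideal. -/
lemma exists_hasSig_of_mem_span (k : ℕ) (h0 : p ≠ 0)
    (hp : p ∈ Ideal.span {g | ∃ j : Fin r, j.val < k ∧ f j = g}) :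
    ∃ ρ : Signature n r, ρ.1.val < k ∧ HasSig m f ρ p := by
  induction k with
  | zero =>
    have h1 : {g | ∃ j : Fin r, j.val < 0 ∧ f j = g} = ∅ := by
      ext g
      simp
    rw [h1, Ideal.span_empty] at hp
    exact absurd hp h0
  | succ k ih =>
    by_cases hk : k < r
    · have h1 : {g | ∃ j : Fin r, j.val < k + 1 ∧ f j = g} =
          insert (f ⟨k, hk⟩) {g | ∃ j : Fin r, j.val < k ∧ f j = g} := by
        ext g
        constructor
        · rintro ⟨j, hj, rfl⟩
          rcases Nat.lt_succ_iff_lt_or_eq.1 hj with hj | hj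
          · exact .inr ⟨j, hj, rfl⟩
          · subst hj
            exact .inl rfl
        · rintro (rfl | ⟨j, hj, rfl⟩)
          · exact ⟨⟨k, hk⟩, by simp, rfl⟩
          · exact ⟨j, by omega, rfl⟩
      rw [h1, Ideal.mem_span_insert] at hp
      obtain ⟨q, z, hz, rfl⟩ := hp
      by_cases hq : q = 0
      · subst hq
        obtain ⟨ρ, hρ, h⟩ := ih (by simpa using hz)
        exact ⟨ρ, by omega, h⟩
      · refine ⟨(⟨k, hk⟩, m.degree q), by simp, q, hq, rfl, ?_⟩
        rw [add_sub_cancel_left]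
        exact hz
    · obtain ⟨ρ, hρ, h⟩ := ih (by
        refine Ideal.span_mono ?_ hp
        rintro _ ⟨j, -, rfl⟩
        exact ⟨j, by omega, rfl⟩)
      exact ⟨ρ, by omega, h⟩

lemma exists_hasSig_of_mem_idealBelow {i : Fin r} (h0 : p ≠ 0) (hp : p ∈ idealBelow f i) :
    ∃ ρ : Signature n r, ρ.1 < i ∧ HasSig m f ρ p :=
  exists_hasSig_of_mem_span i.val h0 hp

lemma exists_hasSig_of_mem_span_range (h0 : p ≠ 0) (hp : p ∈ Ideal.span (Set.range f)) :
    ∃ ρ : Signature n r, HasSig m f ρ p := by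
  obtain ⟨ρ, -, h⟩ := exists_hasSig_of_mem_span (m := m) r h0 (by
    refine Ideal.span_mono ?_ hp
    rintro _ ⟨j, rfl⟩
    exact ⟨j, j.isLt, rfl⟩)
  exact ⟨ρ, h⟩

lemma SigLT.exists_hasSig (h : SigLT m f σ p) (h0 : p ≠ 0) :
    ∃ ρ, Signature.lt m ρ σ ∧ HasSig m f ρ p := by
  obtain ⟨q, hq, hp⟩ := h
  by_cases hq0 : q = 0
  · subst hq0
    obtain ⟨ρ, hρ, h⟩ := exists_hasSig_of_mem_idealBelow (m := m) h0 (by simpa using hp)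
    exact ⟨ρ, .inl hρ, h⟩
  · exact ⟨(σ.1, m.degree q), .inr ⟨rfl, hq.resolve_left hq0⟩, q, hq0, rfl, hp⟩

/-- The least signature at which a given leading monomial occurs. -/
lemma HasSig.exists_minimal (h : HasSig m f σ p) (h0 : p ≠ 0) :
    ∃ ρ p', ¬ Signature.lt m σ ρ ∧ HasSig m f ρ p' ∧ p' ≠ 0 ∧ m.degree p' = m.degree p ∧
      ¬ SigLM m f ρ (m.degree p) := by
  induction σ using Signature.wellFounded_lt (m := m).induction generalizing p with
  | _ σ ih =>
  by_cases hlm : SigLM m f σ (m.degree p)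
  · obtain ⟨p₁, hp₁, h1, h2⟩ := hlm
    obtain ⟨τ, hτ, hp₁'⟩ := hp₁.exists_hasSig h1
    obtain ⟨ρ, p', h3, h4⟩ := ih τ hτ hp₁' h1
    rw [h2] at h4
    exact ⟨ρ, p', fun h => h3 (hτ.trans h), h4⟩
  · exact ⟨σ, p, Signature.not_lt_self, h, h0, rfl, hlm⟩

lemma SigLM.exists_minimal (h : SigLM m f σ e) :
    ∃ ρ p', Signature.lt m ρ σ ∧ HasSig m f ρ p' ∧ p' ≠ 0 ∧ m.degree p' = e ∧
      ¬ SigLM m f ρ e := by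
  obtain ⟨p, hp, h0, rfl⟩ := h
  obtain ⟨τ, hτ, hp'⟩ := hp.exists_hasSig h0
  obtain ⟨ρ, p', h3, h4⟩ := hp'.exists_minimal h0
  exact ⟨ρ, p', Signature.lt_of_not_lt_of_lt h3 hτ, h4⟩

end SGB

/-! ### Correctness for lists whose S-pairs are treated. -/

namespace SGB

open MvPolynomial

variable {K : Type*} [Field K] {n r : ℕ} {m : MonomialOrder (Fin n)}
  {f : Fin r → MvPolynomial (Fin n) K} {σ τ ρ : Signature n r} {a e : Fin n →₀ ℕ}
  {G : List (SigPoly K n r)} {α β : SigPoly K n r} {k l : ℕ}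

/-- The defining properties of an extended sig-poly pair. -/
def Valid (m : MonomialOrder (Fin n)) (f : Fin r → MvPolynomial (Fin n) K)
    (α : SigPoly K n r) : Prop :=
  Rep m f α.sig α.poly α.quo

lemma Valid.hasSig (h : Valid m f α) : HasSig m f α.sig α.poly := ⟨_, h⟩

/-- The entry `α` of `G`, at the position `k`, is the last one whose signature divides `τ`. -/
def IsCanonical (G : List (SigPoly K n r)) (k : ℕ) (α : SigPoly K n r) (τ : Signature n r) :
    Prop :=
  G[k]? = some α ∧ Signature.divides α.sig τ ∧
    ∀ j δ, k < j → G[j]? = some δ → ¬ Signature.divides δ.sig τ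

/-- An element of `G` shows, by the syzygy or the Koszul criterion, that `τ` is the signature of
a syzygy. -/
def SyzWitness (m : MonomialOrder (Fin n)) (G : List (SigPoly K n r)) (τ : Signature n r) : Prop :=
  (∃ δ ∈ G, δ.poly = 0 ∧ Signature.divides δ.sig τ) ∨
    ∃ δ ∈ G, δ.ind < τ.1 ∧ δ.poly ≠ 0 ∧ m.degree δ.poly ≤ τ.2

lemma SyzWitness.mono (h : SyzWitness m G σ) (hd : Signature.divides σ τ) :
    SyzWitness m G τ := by
  rcases h with ⟨δ, hδ, h0, h⟩ | ⟨δ, hδ, h1, h2, h3⟩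
  · exact .inl ⟨δ, hδ, h0, h.trans hd⟩
  · obtain ⟨h4, h5⟩ := Signature.divides_iff.1 hd
    exact .inr ⟨δ, hδ, h4 ▸ h1, h2, h3.trans h5⟩

/-- The syzygy criterion supplies a multiple of an element with zero polynomial part; the Koszul
criterion supplies a quotient that itself lies in the ideal of the smaller indices. -/
lemma SyzWitness.hasSig_zero (hG : ∀ δ ∈ G, Valid m f δ) (h : SyzWitness m G τ) :
    HasSig m f τ 0 := by
  rcases h with ⟨δ, hδ, h0, a, rfl⟩ | ⟨δ, hδ, h1, h2, h3⟩
  · have := (hG δ hδ).hasSig.monomial_mul (a := a) (one_ne_zero (α := K))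
    rwa [h0, mul_zero] at this
  · refine ⟨monomial (τ.2 - m.degree δ.poly) 1 * δ.poly, mul_ne_zero (by simp) h2, ?_, ?_⟩
    · rw [degree_monomial_mul one_ne_zero h2, tsub_add_cancel_of_le h3]
    · rw [zero_sub, neg_mem_iff]
      exact Ideal.mul_mem_right _ _ (Ideal.mul_mem_left _ _ ((hG δ hδ).mem_idealBelow h1))

lemma Valid.degree_monomial_mul_quo (h : Valid m f α) :
    m.degree (monomial a (1 : K) * α.quo) = a + α.sig.2 := by
  rw [degree_monomial_mul one_ne_zero h.1, h.2.1]

/-- The singular criterion cannot apply to the last element whose signature divides `τ`, so one of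
the other two does. -/
lemma Rewritable.syzWitness (hG : ∀ δ ∈ G, Valid m f δ) (hα : IsCanonical G k α τ)
    (ha : Signature.divides (Signature.mul a α.sig) τ) (h : Rewritable m G k α a) :
    SyzWitness m G (Signature.mul a α.sig) := by
  obtain ⟨j, δ, hj, ⟨h1, h2⟩ | ⟨h1, h2⟩ | ⟨h1, h2, h3⟩⟩ := h
  · exact absurd (h1.trans ha) (hα.2.2 j δ h2 hj)
  · exact .inl ⟨δ, List.mem_of_getElem? hj, h2, h1⟩
  · rw [(hG α (List.mem_of_getElem? hα.1)).degree_monomial_mul_quo] at h3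
    exact .inr ⟨δ, List.mem_of_getElem? hj, h1, h2, h3⟩

/-- The initial element of index `τ.1` has a signature dividing `τ`, so there is a last such
element. -/
lemma exists_isCanonical (hinit : ∀ i : Fin r, ∃ δ ∈ G, δ.sig = (i, 0)) (τ : Signature n r) :
    ∃ k α, IsCanonical G k α τ := by
  classical
  have hex : ∃ k, k ≤ G.length ∧ ∃ α, G[k]? = some α ∧ Signature.divides α.sig τ := by
    obtain ⟨δ, hδ, hs⟩ := hinit τ.1
    obtain ⟨k, hk⟩ := List.mem_iff_getElem?.1 hδ
    refine ⟨k, ?_, δ, hk, Signature.divides_iff.2 (by simp [hs])⟩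
    exact (List.getElem?_eq_some_iff.1 hk).1.le
  obtain ⟨k, hk, h⟩ := hex
  obtain ⟨α, h1, h2⟩ := Nat.findGreatest_spec
    (P := fun k => ∃ α, G[k]? = some α ∧ Signature.divides α.sig τ) hk h
  refine ⟨_, α, h1, h2, fun j δ hj hδ hd => ?_⟩
  exact Nat.findGreatest_is_greatest hj (List.getElem?_eq_some_iff.1 hδ).1.le ⟨δ, hδ, hd⟩

/-- Every S-pair of elements of `G` whose signature satisfies `C` has been treated: it is
rewritable or its signature is that of an element that was added later. -/
def Treated (m : MonomialOrder (Fin n)) (G : List (SigPoly K n r)) (C : Signature n r → Prop) :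
    Prop :=
  ∀ (k l : ℕ) (α β : SigPoly K n r), G[k]? = some α → G[l]? = some β → α.poly ≠ 0 → β.poly ≠ 0 →
    Signature.lt m (Signature.mul (cofactor m β.poly α.poly) β.sig)
      (Signature.mul (cofactor m α.poly β.poly) α.sig) →
    C (Signature.mul (cofactor m α.poly β.poly) α.sig) →
    Rewritable m G k α (cofactor m α.poly β.poly) ∨
      Rewritable m G l β (cofactor m β.poly α.poly) ∨
      ∃ j γ, k < j ∧ G[j]? = some γ ∧ γ.sig = Signature.mul (cofactor m α.poly β.poly) α.sig

lemma exists_add_cofactor {u v : Fin n →₀ ℕ} {p q : MvPolynomial (Fin n) K}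
    (h : u + m.degree p = v + m.degree q) :
    ∃ c, u = c + cofactor m p q ∧ v = c + cofactor m q p := by
  refine ⟨u + m.degree p - (m.degree p ⊔ m.degree q), ?_, ?_⟩ <;> ext i <;>
  · have := DFunLike.congr_fun h i
    simp only [cofactor, Finsupp.coe_add, Finsupp.coe_tsub, Pi.add_apply, Pi.sub_apply,
      Finsupp.sup_apply] at this ⊢
    omega

/-- The hypotheses of the correctness theorems: the elements of `G` are sig-poly pairs, each index
has an initial element, and the S-pairs with signature in the initial segment `C` are treated. -/
structure IsComplete (m : MonomialOrder (Fin n)) (f : Fin r → MvPolynomial (Fin n) K)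
    (G : List (SigPoly K n r)) (C : Signature n r → Prop) : Prop where
  valid : ∀ δ ∈ G, Valid m f δ
  initial : ∀ i : Fin r, ∃ δ ∈ G, δ.sig = (i, 0)
  lower : ∀ s t, C t → ¬ Signature.lt m t s → C s
  treated : Treated m G C

variable {C : Signature n r → Prop}

lemma IsComplete.syzWitness_or_not_sigLM (h : IsComplete m f G C) (hτ : C τ)
    (hα : IsCanonical G k (α := α) (τ := τ)) (ha : Signature.mul a α.sig = τ) :
    SyzWitness m G τ ∨ α.poly ≠ 0 ∧ ¬ SigLM m f τ (a + m.degree α.poly) := by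
  induction τ using Signature.wellFounded_lt (m := m).induction generalizing k α a with
  | _ τ ih =>
  by_cases h0 : α.poly = 0
  · exact .inl (.inl ⟨α, List.mem_of_getElem? hα.1, h0, hα.2.1⟩)
  refine or_iff_not_imp_right.2 fun hlm => ?_
  replace hlm : SigLM m f τ (a + m.degree α.poly) := by
    by_contra hn
    exact hlm ⟨h0, hn⟩
  obtain ⟨ρ, p, hρ, hp, hp0, hpe, hpl⟩ := hlm.exists_minimal
  obtain ⟨l, β, hβ⟩ := exists_isCanonical h.initial ρ
  obtain ⟨b, hb⟩ := hβ.2.1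
  have hmin : ∀ p', HasSig m f ρ p' → p' ≠ 0 ∧ m.degree p ≼[m] m.degree p' := fun p' hp' =>
    hp.degree_le_of_not_sigLM hp0 (by rwa [hpe]) hp'
  have hns : ¬ SyzWitness m G ρ := fun hs => (hmin 0 (hs.hasSig_zero h.valid)).1 rfl
  have hCρ : C ρ := h.lower _ _ hτ fun h' => Signature.not_lt_self (h'.trans hρ)
  obtain ⟨hβ0, hβl⟩ := (ih ρ hρ hCρ hβ hb).resolve_left hns
  have hβs : HasSig m f ρ (monomial b 1 * β.poly) := by
    rw [← hb]
    exact (h.valid β (List.mem_of_getElem? hβ.1)).hasSig.monomial_mul one_ne_zero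
  have hbd : m.degree (monomial b 1 * β.poly) = b + m.degree β.poly :=
    degree_monomial_mul one_ne_zero hβ0
  -- Both `p` and `b β` have the least leading monomial at `ρ`, so these agree.
  have hbe : a + m.degree α.poly = b + m.degree β.poly := by
    rw [← hpe, ← hbd]
    refine m.toSyn.injective (le_antisymm (hmin _ hβs).2 ?_)
    exact (hβs.degree_le_of_not_sigLM (hmin _ hβs).1 (by rwa [hbd]) hp).2
  obtain ⟨c, hac, hbc⟩ := exists_add_cofactor hbe
  -- Cancelling the common factor `c` from `ρ < τ` shows that the S-pair is regular, with `α` on the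
  -- larger side.
  have hlt : Signature.lt m (Signature.mul (cofactor m β.poly α.poly) β.sig)
      (Signature.mul (cofactor m α.poly β.poly) α.sig) := by
    rw [← Signature.mul_lt_mul (a := c), Signature.mul_mul, Signature.mul_mul, ← hac, ← hbc, ha, hb]
    exact hρ
  have hdα : Signature.divides (Signature.mul (cofactor m α.poly β.poly) α.sig) τ :=
    ⟨c, by rw [Signature.mul_mul, ← hac, ha]⟩
  have hdβ : Signature.divides (Signature.mul (cofactor m β.poly α.poly) β.sig) ρ :=
    ⟨c, by rw [Signature.mul_mul, ← hbc, hb]⟩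
  rcases h.treated k l α β hα.1 hβ.1 h0 hβ0 hlt (h.lower _ _ hτ hdα.not_lt) with
    hr | hr | ⟨j, γ, hj, hγ, hs⟩
  · exact (hr.syzWitness h.valid hα hdα).mono hdα
  · exact absurd ((hr.syzWitness h.valid hβ hdβ).mono hdβ) hns
  · exact absurd (hs ▸ hdα) (hα.2.2 j γ hj hγ)

/-- `G` contains a reducer, of small signature, for every polynomial with a signature in `C`. -/
lemma IsComplete.exists_reducer (h : IsComplete m f G C) {p : MvPolynomial (Fin n) K}
    (hp : HasSig m f τ p) (hp0 : p ≠ 0) (hτ : C τ) :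
    ∃ β ∈ G, ∃ b, β.poly ≠ 0 ∧ b + m.degree β.poly = m.degree p ∧
      ¬ Signature.lt m τ (Signature.mul b β.sig) := by
  obtain ⟨ρ, p', hρ, hp', hp0', hpe, hlm⟩ := hp.exists_minimal hp0
  obtain ⟨l, β, hβ⟩ := exists_isCanonical h.initial ρ
  obtain ⟨b, hb⟩ := hβ.2.1
  have hmin : ∀ p₁, HasSig m f ρ p₁ → p₁ ≠ 0 ∧ m.degree p' ≼[m] m.degree p₁ := fun p₁ hp₁ =>
    hp'.degree_le_of_not_sigLM hp0' (by rwa [hpe]) hp₁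
  obtain ⟨hβ0, hβl⟩ := (h.syzWitness_or_not_sigLM (h.lower _ _ hτ hρ) hβ hb).resolve_left
    fun hs => (hmin 0 (hs.hasSig_zero h.valid)).1 rfl
  have hβs : HasSig m f ρ (monomial b 1 * β.poly) := by
    rw [← hb]
    exact (h.valid β (List.mem_of_getElem? hβ.1)).hasSig.monomial_mul one_ne_zero
  have hbd : m.degree (monomial b 1 * β.poly) = b + m.degree β.poly :=
    degree_monomial_mul one_ne_zero hβ0
  refine ⟨β, List.mem_of_getElem? hβ.1, b, hβ0, ?_, by rwa [hb]⟩
  rw [← hpe, ← hbd]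
  -- Again two polynomials with the least leading monomial at `ρ`.
  refine m.toSyn.injective (le_antisymm ?_ (hmin _ hβs).2)
  exact (hβs.degree_le_of_not_sigLM (hmin _ hβs).1 (by rwa [hbd]) hp').2

/-- The signatures of syzygies are recognized by the syzygy or the Koszul criterion. -/
lemma IsComplete.syzWitness (h : IsComplete m f G C) (hs : HasSig m f τ 0) (hτ : C τ) :
    SyzWitness m G τ := by
  obtain ⟨k, α, hα⟩ := exists_isCanonical h.initial τ
  obtain ⟨a, ha⟩ := hα.2.1
  refine (h.syzWitness_or_not_sigLM hτ hα ha).resolve_right fun ⟨h0, hlm⟩ => ?_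
  have hαs : HasSig m f τ (monomial a 1 * α.poly) := by
    rw [← ha]
    exact (h.valid α (List.mem_of_getElem? hα.1)).hasSig.monomial_mul one_ne_zero
  exact (hαs.degree_le_of_not_sigLM (mul_ne_zero (by simp) h0)
    (by rwa [degree_monomial_mul one_ne_zero h0]) hs).1 rfl

end SGB

/-! ### The invariants of the algorithm. -/

namespace SGB

open MvPolynomial

variable {K : Type*} [Field K] {n r : ℕ} {m : MonomialOrder (Fin n)}
  {f : Fin r → MvPolynomial (Fin n) K}
  {G G' : List (SigPoly K n r)} {α β γ γ' : SigPoly K n r} {k l : ℕ}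

lemma cofactor_add_degree {p q : MvPolynomial (Fin n) K} :
    cofactor m p q + m.degree p = cofactor m q p + m.degree q := by
  rw [cofactor, cofactor, tsub_add_cancel_of_le le_sup_left, tsub_add_cancel_of_le le_sup_left,
    sup_comm]

lemma Valid.sPairOrdered (hα : Valid m f α) (hβ : Valid m f β) (h : IsRegularPair m α β)
    (hle : ¬ Signature.lt m α.sig β.sig) : Valid m f (sPairOrdered m α β) := by
  obtain ⟨hα0, hβ0, hne⟩ := h
  have hα' := Rep.monomial_mul (a := cofactor m α.poly β.poly)
    (c := (m.leadingCoeff α.poly)⁻¹) (by simpa using hα0) hα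
  have hβ' := Rep.monomial_mul (a := cofactor m β.poly α.poly)
    (c := (m.leadingCoeff β.poly)⁻¹) (by simpa using hβ0) hβ
  have hind : ¬ α.ind < β.ind := fun h => hle (.inl h)
  unfold Valid SGB.sPairOrdered
  dsimp only
  rcases Signature.lt_trichotomy (m := m) (s := Signature.mul (cofactor m α.poly β.poly) α.sig)
    (t := Signature.mul (cofactor m β.poly α.poly) β.sig) with hlt | heq | hlt
  · have he : α.ind = β.ind := by
      rcases hlt with h | ⟨h, -⟩
      · exact absurd h hind
      · exact h
    rw [Signature.max_of_lt hlt, if_neg (by simp [he])]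
    -- Multiplication by the cofactors may reverse the order when the indices agree; the leading
    -- term of the quotient then comes from `β`, with a sign.
    have := (hβ'.sub_of_eq hα' hlt he).neg
    rwa [neg_sub, neg_sub] at this
  · exact absurd heq hne
  · rw [Signature.max_of_lt' hlt]
    split_ifs with hi
    · exact hα'.sub_of_lt hβ' hi
    · exact hα'.sub_of_eq hβ' hlt (le_antisymm (not_lt.1 hind) (not_lt.1 hi))

lemma IsRegularPair.symm (h : IsRegularPair m α β) : IsRegularPair m β α :=
  ⟨h.2.1, h.1, h.2.2.symm⟩

lemma Valid.sPair (hα : Valid m f α) (hβ : Valid m f β) (h : IsRegularPair m α β) :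
    Valid m f (sPair m α β) := by
  unfold SGB.sPair
  split_ifs with hlt
  · exact hβ.sPairOrdered hα h.symm fun h' => Signature.not_lt_self (hlt.trans h')
  · exact hα.sPairOrdered hβ h hlt

/-- `sPair` orders its members by their own signatures, not those of the multiples; the maximum
makes this irrelevant for the resulting signature. -/
lemma sPair_sig_of_lt
    (h : Signature.lt m (Signature.mul (cofactor m β.poly α.poly) β.sig)
      (Signature.mul (cofactor m α.poly β.poly) α.sig)) :
    (sPair m α β).sig = Signature.mul (cofactor m α.poly β.poly) α.sig := by
  unfold sPair
  split_ifs
  · exact Signature.max_of_lt h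
  · exact Signature.max_of_lt' h

lemma sPair_sig_of_lt'
    (h : Signature.lt m (Signature.mul (cofactor m β.poly α.poly) β.sig)
      (Signature.mul (cofactor m α.poly β.poly) α.sig)) :
    (sPair m β α).sig = Signature.mul (cofactor m α.poly β.poly) α.sig := by
  unfold sPair
  split_ifs
  · exact Signature.max_of_lt' h
  · exact Signature.max_of_lt h

lemma RegRedStep.valid (h : RegRedStep m G γ γ') (hG : ∀ δ ∈ G, Valid m f δ)
    (hγ : Valid m f γ) : Valid m f γ' := by
  obtain ⟨β, hβ, h0, hβ0, hd, hlt, hp, hs, hq, hq'⟩ := h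
  have hβ' := Rep.monomial_mul (a := m.degree γ.poly - m.degree β.poly)
    (c := m.leadingCoeff γ.poly / m.leadingCoeff β.poly) (by simp [h0, hβ0]) (hG β hβ)
  unfold Valid
  rw [hp, hs]
  by_cases hi : β.ind = γ.ind
  · rw [hq hi]
    exact Rep.sub_of_eq hγ hβ' hlt hi
  · rw [hq' hi]
    refine Rep.sub_of_lt hγ hβ' ?_
    rcases hlt with h | ⟨h, -⟩
    · exact h
    · exact absurd h hi

lemma RegRedStep.degree_lt (h : RegRedStep m G γ γ') :
    γ.poly ≠ 0 ∧ (γ'.poly = 0 ∨ m.degree γ'.poly ≺[m] m.degree γ.poly) := by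
  obtain ⟨β, hβ, h0, hβ0, hd, hlt, hp, -⟩ := h
  refine ⟨h0, ?_⟩
  have h1 : m.degree (monomial (m.degree γ.poly - m.degree β.poly) (1 : K) * β.poly) =
      m.degree γ.poly := by
    rw [degree_monomial_mul one_ne_zero hβ0, tsub_add_cancel_of_le hd]
  have h2 := degree_sub_C_mul_lt (m := m) (p := γ.poly) (mul_ne_zero (by simp) hβ0) h1.symm
  rw [m.leadingCoeff_mul, m.leadingCoeff_monomial, one_mul, ← mul_assoc, C_mul_monomial,
    mul_one] at h2
  rw [hp]
  exact h2

lemma exists_regRedStep (hβ : β ∈ G) (h0 : γ.poly ≠ 0) (hβ0 : β.poly ≠ 0) {b : Fin n →₀ ℕ}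
    (hb : b + m.degree β.poly = m.degree γ.poly)
    (hlt : Signature.lt m (Signature.mul b β.sig) γ.sig) : ∃ γ', RegRedStep m G γ γ' := by
  classical
  have hb' : m.degree γ.poly - m.degree β.poly = b := by rw [← hb, add_tsub_cancel_right]
  refine ⟨⟨γ.poly - ltQuot m γ.poly β.poly * β.poly, γ.sig,
    if β.ind = γ.ind then γ.quo - ltQuot m γ.poly β.poly * β.quo else γ.quo⟩, β, hβ, h0, hβ0,
    hb ▸ le_add_self, by rwa [hb'], rfl, rfl, fun h => if_pos h, fun h => if_neg h⟩

/-- What is known of an element `γ` at the moment at which it is added to the list `G`. -/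
structure InsertedAfter (m : MonomialOrder (Fin n)) (f : Fin r → MvPolynomial (Fin n) K)
    (G : List (SigPoly K n r)) (γ : SigPoly K n r) : Prop where
  not_divides : ∀ δ ∈ G, δ.poly = 0 → ¬ Signature.divides δ.sig γ.sig
  parent : ∃ (j : ℕ) (α : SigPoly K n r) (a : Fin n →₀ ℕ), G[j]? = some α ∧
    Signature.mul a α.sig = γ.sig ∧
    (∀ (i : ℕ) (δ : SigPoly K n r), j < i → G[i]? = some δ → ¬ Signature.divides δ.sig γ.sig) ∧
    α.poly ≠ 0 ∧ SigLM m f γ.sig (a + m.degree α.poly)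
  not_sigLM : γ.poly ≠ 0 → ¬ SigLM m f γ.sig (m.degree γ.poly)

/-- Positions do not change when `G` grows at its end, so a discarded pair stays treated. -/
lemma Rewritable.append {a : Fin n →₀ ℕ} (h : Rewritable m G k α a) :
    Rewritable m (G ++ G') k α a := by
  obtain ⟨j, δ, hj, h⟩ := h
  refine ⟨j, δ, ?_, h⟩
  rwa [List.getElem?_append_left (List.getElem?_eq_some_iff.1 hj).1]

/-- The invariant of the main loop. -/
structure Inv (m : MonomialOrder (Fin n)) (f : Fin r → MvPolynomial (Fin n) K)
    (v : Vars K n r) : Prop where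
  valid : ∀ δ ∈ v.G, Valid m f δ
  initial : ∀ i : Fin r, v.G[i.val]? = some ⟨f i, (i, 0), 1⟩
  pairs : v.P ⊆ regularPairs m v.G
  treated : ∀ (k l : ℕ) (α β : SigPoly K n r), l < k → v.G[k]? = some α →
    v.G[l]? = some β → IsRegularPair m α β →
    (k, l) ∈ v.P ∨ PairRewritable m v k l α β ∨
      ∃ (j : ℕ) (γ : SigPoly K n r), k < j ∧ v.G[j]? = some γ ∧ γ.sig = (sPair m α β).sig
  inserted : ∀ (k : ℕ) (γ : SigPoly K n r), r ≤ k → v.G[k]? = some γ →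
    InsertedAfter m f (v.G.take k) γ
  exists_of_mem_S : ∀ i, ∀ h ∈ v.S i, ∃ δ ∈ v.G, δ.poly = 0 ∧ δ.ind = i ∧ δ.quo = h
  mem_S : ∀ (k : ℕ) (δ : SigPoly K n r), r ≤ k → v.G[k]? = some δ → δ.poly = 0 → δ.quo ∈ v.S δ.ind

/-- The invariant of the regular reduction. -/
def RInv (m : MonomialOrder (Fin n)) (f : Fin r → MvPolynomial (Fin n) K)
    (v : Vars K n r) (γ : SigPoly K n r) : Prop :=
  ∃ v₀ k l α β, v = { v₀ with P := v₀.P \ {(k, l)} } ∧ Inv m f v₀ ∧ IsMinimalPair m v₀ k l α β ∧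
    ¬ PairRewritable m v₀ k l α β ∧ Valid m f γ ∧ γ.sig = (sPair m α β).sig

variable {v : Vars K n r}

lemma Inv.finite (h : Inv m f v) : v.P.Finite := by
  refine ((Set.finite_Iio v.G.length).prod (Set.finite_Iio v.G.length)).subset fun p hp => ?_
  obtain ⟨-, α, β, h1, h2, -⟩ := h.pairs hp
  exact ⟨(List.getElem?_eq_some_iff.1 h1).1, (List.getElem?_eq_some_iff.1 h2).1⟩

/-- The invariant orders a pair by position, completeness orders it by signature; hence the case
distinction on positions. -/
lemma Inv.isComplete (h : Inv m f v) {C : Signature n r → Prop}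
    (hC : ∀ s t, C t → ¬ Signature.lt m t s → C s)
    (hP : ∀ (k l : ℕ) (α β : SigPoly K n r), (k, l) ∈ v.P → v.G[k]? = some α → v.G[l]? = some β →
      ¬ C (sPair m α β).sig) : IsComplete m f v.G C where
  valid := h.valid
  initial i := ⟨_, List.mem_of_getElem? (h.initial i), rfl⟩
  lower := hC
  treated := by
    intro k l α β hk hl hα hβ hlt hCs
    have hreg : IsRegularPair m α β :=
      ⟨hα, hβ, fun h => Signature.not_lt_self (h ▸ hlt)⟩
    rcases lt_trichotomy l k with hlk | rfl | hkl
    · have hs := sPair_sig_of_lt hlt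
      rcases h.treated k l α β hlk hk hl hreg with h1 | (h1 | h1) | ⟨j, γ, hj, hγ, h1⟩
      · exact absurd (hs ▸ hCs) (hP k l α β h1 hk hl)
      · exact .inl h1
      · exact .inr (.inl h1)
      · exact .inr (.inr ⟨j, γ, hj, hγ, h1.trans hs⟩)
    · obtain rfl : α = β := by simpa using hk.symm.trans hl
      exact absurd hlt Signature.not_lt_self
    · have hs := sPair_sig_of_lt' hlt
      rcases h.treated l k β α hkl hl hk hreg.symm with h1 | (h1 | h1) | ⟨j, γ, hj, hγ, h1⟩
      · exact absurd (hs ▸ hCs) (hP l k β α h1 hl hk)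
      · exact .inr (.inl h1)
      · exact .inl h1
      · exact .inr (.inr ⟨j, γ, hkl.trans hj, hγ, h1.trans hs⟩)

/-- By the minimal choice of the pair, no waiting pair has a signature below that of `γ`. -/
lemma RInv.isComplete (h : RInv m f v γ) :
    IsComplete m f v.G fun s => Signature.lt m s γ.sig := by
  obtain ⟨v₀, k, l, α, β, rfl, hv, hmin, -, -, hs⟩ := h
  refine hv.isComplete (fun s t ht hts => Signature.lt_of_not_lt_of_lt hts ht) ?_
  intro k' l' α' β' hP hk hl
  rw [hs]
  exact hmin.2.2.2 k' l' α' β' hP hk hl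

/-- The member of the selected S-pair with the larger signature. -/
lemma RInv.exists_parent (h : RInv m f v γ) :
    ∃ (j : ℕ) (α : SigPoly K n r) (a : Fin n →₀ ℕ), v.G[j]? = some α ∧
      Signature.mul a α.sig = γ.sig ∧ ¬ Rewritable m v.G j α a ∧
      α.poly ≠ 0 ∧ SigLM m f γ.sig (a + m.degree α.poly) := by
  obtain ⟨v₀, k, l, α, β, rfl, hv, ⟨hP, hk, hl, -⟩, hrw, -, hs⟩ := h
  obtain ⟨-, α', β', hk', hl', hα, hβ, hne⟩ := hv.pairs hP
  obtain rfl : α = α' := by simpa using hk.symm.trans hk'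
  obtain rfl : β = β' := by simpa using hl.symm.trans hl'
  rw [PairRewritable, not_or] at hrw
  -- Both multiples have the lcm as leading monomial, so the smaller one shows that it occurs below
  -- the signature of the larger one.
  have key : ∀ α β : SigPoly K n r, α ∈ v₀.G → α.poly ≠ 0 → β.poly ≠ 0 →
      Signature.lt m (Signature.mul (cofactor m α.poly β.poly) α.sig)
        (Signature.mul (cofactor m β.poly α.poly) β.sig) →
      SigLM m f (Signature.mul (cofactor m β.poly α.poly) β.sig)
        (cofactor m β.poly α.poly + m.degree β.poly) := by
    intro α β hαG hα hβ hlt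
    refine ⟨monomial (cofactor m α.poly β.poly) 1 * α.poly, ?_, mul_ne_zero (by simp) hα, ?_⟩
    · exact ((hv.valid α hαG).hasSig.monomial_mul one_ne_zero).sigLT hlt
    · rw [degree_monomial_mul one_ne_zero hα, cofactor_add_degree]
  rcases Signature.lt_trichotomy (m := m) (s := Signature.mul (cofactor m α.poly β.poly) α.sig)
    (t := Signature.mul (cofactor m β.poly α.poly) β.sig) with hlt | heq | hlt
  · rw [sPair_sig_of_lt' hlt] at hs
    exact ⟨l, β, _, hl, hs.symm, hrw.2, hβ, hs ▸ key α β (List.mem_of_getElem? hk) hα hβ hlt⟩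
  · exact absurd heq hne
  · rw [sPair_sig_of_lt hlt] at hs
    exact ⟨k, α, _, hk, hs.symm, hrw.1, hα, hs ▸ key β α (List.mem_of_getElem? hl) hβ hα hlt⟩

/-- Non-rewritability of the parent's multiple gives the divisibility statements. If `lm(γ)`
occurred at a smaller signature, completeness below `γ` would provide a regular reducer. -/
lemma RInv.insertedAfter (h : RInv m f v γ) (hirr : ∀ γ', ¬ RegRedStep m v.G γ γ') :
    InsertedAfter m f v.G γ := by
  obtain ⟨j, α, a, hj, hs, hrw, hα, hlm⟩ := h.exists_parent
  refine ⟨fun δ hδ h0 hd => ?_, ⟨j, α, a, hj, hs, fun i δ hi hδ hd => ?_, hα, hlm⟩,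
    fun h0 hlm' => ?_⟩
  · obtain ⟨i, hi⟩ := List.mem_iff_getElem?.1 hδ
    exact hrw ⟨i, δ, hi, .inr (.inl ⟨hs ▸ hd, h0⟩)⟩
  · exact hrw ⟨i, δ, hδ, .inl ⟨hs ▸ hd, hi⟩⟩
  · obtain ⟨p, hp, hp0, hpe⟩ := hlm'
    obtain ⟨ρ, hρ, hpρ⟩ := hp.exists_hasSig hp0
    obtain ⟨β, hβ, b, hβ0, hb, hlt⟩ := h.isComplete.exists_reducer hpρ hp0 hρ
    obtain ⟨γ', hγ'⟩ := exists_regRedStep (m := m) hβ h0 hβ0 (hb.trans hpe)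
      (Signature.lt_of_not_lt_of_lt hlt hρ)
    exact hirr γ' hγ'

lemma getElem?_append_singleton {X : Type*} {G : List X} {γ δ : X} {k : ℕ}
    (h : (G ++ [γ])[k]? = some δ) : G[k]? = some δ ∨ k = G.length ∧ δ = γ := by
  rcases lt_trichotomy k G.length with hk | rfl | hk
  · rw [List.getElem?_append_left hk] at h
    exact .inl h
  · rw [List.getElem?_concat_length] at h
    exact .inr ⟨rfl, by simpa using h.symm⟩
  · rw [List.getElem?_eq_none (by simp; omega)] at h
    simp at h

lemma getElem?_append_of_eq_some {X : Type*} {G G' : List X} {δ : X} {k : ℕ}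
    (h : G[k]? = some δ) : (G ++ G')[k]? = some δ := by
  rwa [List.getElem?_append_left (List.getElem?_eq_some_iff.1 h).1]

lemma regularPairs_append : regularPairs m G ⊆ regularPairs m (G ++ G') := by
  rintro p ⟨h, α, β, h1, h2, h3⟩
  exact ⟨h, α, β, getElem?_append_of_eq_some h1, getElem?_append_of_eq_some h2, h3⟩

lemma RInv.append (h : RInv m f v γ) (hirr : ∀ γ', ¬ RegRedStep m v.G γ γ')
    {P : Set (ℕ × ℕ)} {S : Fin r → Set (MvPolynomial (Fin n) K)}
    (hP : P ⊆ regularPairs m (v.G ++ [γ])) (hvP : v.P ⊆ P)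
    (hP' : ∀ p ∈ regularPairs m (v.G ++ [γ]), p.1 = v.G.length → p ∈ P)
    (hS : ∀ i, v.S i ⊆ S i) (hS' : ∀ i, ∀ h ∈ S i, h ∈ v.S i ∨ γ.poly = 0 ∧ γ.ind = i ∧ γ.quo = h)
    (hγS : γ.poly = 0 → γ.quo ∈ S γ.ind) :
    Inv m f { G := v.G ++ [γ], P := P, S := S } := by
  have hins := h.insertedAfter hirr
  obtain ⟨v₀, k₀, l₀, α₀, β₀, rfl, hv, ⟨-, hk₀, hl₀, -⟩, -, hγ, hs⟩ := h
  have hlen := (List.getElem?_eq_some_iff.1 hk₀).1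
  dsimp only at *
  constructor
  · intro δ hδ
    rcases List.mem_append.1 hδ with hδ | hδ
    · exact hv.valid δ hδ
    · rwa [List.mem_singleton.1 hδ]
  · exact fun i => getElem?_append_of_eq_some (hv.initial i)
  · exact hP
  · intro k l α β hlk hk hl hreg
    dsimp only at *
    rcases getElem?_append_singleton hk with hk' | ⟨rfl, rfl⟩
    · rcases getElem?_append_singleton hl with hl' | ⟨rfl, rfl⟩
      · rcases hv.treated k l α β hlk hk' hl' hreg with h1 | (h1 | h1) | ⟨j, δ, hj, hδ, h1⟩
        · by_cases he : (k, l) = (k₀, l₀)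
          · obtain ⟨rfl, rfl⟩ := Prod.mk.inj he
            obtain rfl : α₀ = α := by simpa using hk₀.symm.trans hk'
            obtain rfl : β₀ = β := by simpa using hl₀.symm.trans hl'
            -- The selected pair, no longer waiting, is treated by `γ` itself.
            exact .inr (.inr ⟨v₀.G.length, γ, hlen, List.getElem?_concat_length, hs⟩)
          · exact .inl (hvP ⟨h1, he⟩)
        · exact .inr (.inl (.inl h1.append))
        · exact .inr (.inl (.inr h1.append))
        · exact .inr (.inr ⟨j, δ, hj, getElem?_append_of_eq_some hδ, h1⟩)
      · exact absurd hlk (List.getElem?_eq_some_iff.1 hk').1.not_gt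
    · exact .inl (hP' _ ⟨hlk, α, β, hk, hl, hreg⟩ rfl)
  · intro k δ hrk hk
    dsimp only at *
    rcases getElem?_append_singleton hk with hk' | ⟨rfl, rfl⟩
    · rw [List.take_append_of_le_length (List.getElem?_eq_some_iff.1 hk').1.le]
      exact hv.inserted k δ hrk hk'
    · rwa [List.take_append_of_le_length le_rfl, List.take_length]
  · intro i h hi
    rcases hS' i h hi with hi' | ⟨h1, h2, h3⟩
    · obtain ⟨δ, hδ, h1⟩ := hv.exists_of_mem_S i h hi'
      exact ⟨δ, List.mem_append_left _ hδ, h1⟩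
    · exact ⟨γ, by simp, h1, h2, h3⟩
  · intro k δ hrk hk h0
    rcases getElem?_append_singleton hk with hk' | ⟨rfl, rfl⟩
    · exact hS _ (hv.mem_S k δ hrk hk' h0)
    · exact hγS h0

lemma inv_init : Inv m f { G := initG f, P := regularPairs m (initG f), S := fun _ => ∅ } where
  valid δ hδ := by
    obtain ⟨i, rfl⟩ := List.mem_ofFn.1 hδ
    exact ⟨one_ne_zero, m.degree_one, by simp⟩
  initial i := by simp [initG]
  pairs := subset_rfl
  treated k l α β hlk hk hl h := .inl ⟨hlk, α, β, hk, hl, h⟩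
  inserted k γ hk hγ := absurd (List.getElem?_eq_some_iff.1 hγ).1 (by simpa [initG] using hk)
  exists_of_mem_S i h hi := absurd hi (Set.notMem_empty _)
  mem_S k γ hk hγ := absurd (List.getElem?_eq_some_iff.1 hγ).1 (by simpa [initG] using hk)

/-- The invariant of the algorithm. -/
def StateInv (m : MonomialOrder (Fin n)) (f : Fin r → MvPolynomial (Fin n) K) :
    State K n r → Prop
  | .main v => Inv m f v
  | .reducing v γ => RInv m f v γ

lemma not_regRedStep_of_poly_eq_zero (h : γ.poly = 0) : ¬ RegRedStep m G γ γ' :=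
  fun ⟨_, _, h0, _⟩ => h0 h

lemma StateInv.step {s s' : State K n r} (h : StateInv m f s) (hs : Step m s s') :
    StateInv m f s' := by
  cases hs with
  | discard v k l α β hmin hrw =>
    have hv : Inv m f v := h
    refine ⟨hv.valid, hv.initial, Set.sdiff_subset.trans hv.pairs, ?_, hv.inserted,
      hv.exists_of_mem_S, hv.mem_S⟩
    intro k' l' α' β' hlk hk hl hreg
    rcases hv.treated k' l' α' β' hlk hk hl hreg with h1 | h1
    · by_cases he : (k', l') = (k, l)
      · obtain ⟨rfl, rfl⟩ := Prod.mk.inj he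
        obtain rfl : α = α' := by simpa using hmin.2.1.symm.trans hk
        obtain rfl : β = β' := by simpa using hmin.2.2.1.symm.trans hl
        exact .inr (.inl hrw)
      · exact .inl ⟨h1, he⟩
    · exact .inr h1
  | select v k l α β hmin hrw =>
    have hv : Inv m f v := h
    obtain ⟨-, α', β', hk', hl', hreg⟩ := hv.pairs hmin.1
    obtain rfl : α = α' := by simpa using hmin.2.1.symm.trans hk'
    obtain rfl : β = β' := by simpa using hmin.2.2.1.symm.trans hl'
    exact ⟨v, k, l, α, β, rfl, hv, hmin, hrw, (hv.valid α (List.mem_of_getElem? hk')).sPair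
      (hv.valid β (List.mem_of_getElem? hl')) hreg, rfl⟩
  | reduce v γ γ' hred =>
    obtain ⟨v₀, k, l, α, β, rfl, hv, hmin, hrw, hγ, hs⟩ := h
    refine ⟨v₀, k, l, α, β, rfl, hv, hmin, hrw, hred.valid hv.valid hγ, ?_⟩
    obtain ⟨-, -, -, -, -, -, -, hs', -⟩ := hred
    exact hs'.trans hs
  | insert v γ hirr hγ =>
    have hR : RInv m f v γ := h
    refine hR.append hirr (Set.union_subset ?_ fun p hp => hp.1) Set.subset_union_left
      (fun p hp hp1 => .inr ⟨hp, hp1⟩) (fun i => subset_rfl) (fun i h hi => .inl hi)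
      fun h0 => absurd h0 hγ
    obtain ⟨v₀, k, l, α, β, rfl, hv, -⟩ := hR
    exact Set.sdiff_subset.trans (hv.pairs.trans regularPairs_append)
  | record v γ hγ =>
    have hR : RInv m f v γ := h
    refine hR.append (fun γ' => not_regRedStep_of_poly_eq_zero hγ) ?_ subset_rfl ?_ ?_ ?_ ?_
    · obtain ⟨v₀, k, l, α, β, rfl, hv, -⟩ := hR
      exact Set.sdiff_subset.trans (hv.pairs.trans regularPairs_append)
    -- An element with zero polynomial part forms no regular S-pair, so no pair is missed.
    · rintro ⟨k, l⟩ ⟨-, α, β, hk, -, h0, -⟩ rfl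
      rw [List.getElem?_concat_length] at hk
      exact absurd hγ (Option.some_injective _ hk ▸ h0)
    · intro i h hi
      by_cases he : i = γ.ind
      · subst he
        simp [hi]
      · simpa [he] using hi
    · intro i h hi
      by_cases he : i = γ.ind
      · subst he
        simpa [hγ, eq_comm, or_comm] using hi
      · exact .inl (by simpa [he] using hi)
    · simp

lemma Reachable.stateInv {s : State K n r} (h : Reachable m f s) : StateInv m f s := by
  induction h with
  | refl => exact inv_init
  | tail _ hs ih => exact ih.step hs

/-- A run can only stop at the head of the main loop with an empty set of pairs. -/
lemma StateInv.eq_main_of_final {s : State K n r} (h : StateInv m f s)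
    (hs : ∀ s', ¬ Step m s s') : ∃ v : Vars K n r, s = .main v ∧ v.P = ∅ := by
  rcases s with v | ⟨v, γ⟩
  · refine ⟨v, rfl, Set.eq_empty_iff_forall_notMem.2 fun p hp => ?_⟩
    have hv : Inv m f v := h
    let A : Set (Signature n r) := {s | ∃ (k l : ℕ) (α β : SigPoly K n r), (k, l) ∈ v.P ∧
      v.G[k]? = some α ∧ v.G[l]? = some β ∧ (sPair m α β).sig = s}
    have hA : A.Nonempty := by
      obtain ⟨-, α, β, hk, hl, -⟩ := hv.pairs hp
      exact ⟨_, p.1, p.2, α, β, hp, hk, hl, rfl⟩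
    obtain ⟨_, ⟨k, l, α, β, hP, hk, hl, rfl⟩, hmin⟩ :=
      (Signature.wellFounded_lt (m := m)).has_min A hA
    have hmin' : IsMinimalPair m v k l α β := ⟨hP, hk, hl, fun k' l' α' β' hP' hk' hl' =>
      hmin _ ⟨k', l', α', β', hP', hk', hl', rfl⟩⟩
    by_cases hrw : PairRewritable m v k l α β
    · exact hs _ (.discard v k l α β hmin' hrw)
    · exact hs _ (.select v k l α β hmin' hrw)
  · exfalso
    by_cases h0 : γ.poly = 0
    · exact hs _ (.record v γ h0)
    · by_cases hirr : ∃ γ', RegRedStep m v.G γ γ'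
      · obtain ⟨γ', hγ'⟩ := hirr
        exact hs _ (.reduce v γ γ' hγ')
      · exact hs _ (.insert v γ (not_exists.1 hirr) h0)

end SGB

/-! ### Termination. -/

namespace SGB

open MvPolynomial

section Dickson

variable {n r : ℕ}

/-- Pigeonhole on the colour `c`, then the well-quasi-order along the enumeration of an infinite
colour class. -/
lemma exists_lt_le_of_infinite {ι X : Type*} [Finite ι] [Preorder X] [WellQuasiOrderedLE X]
    {A : Set ℕ} (hA : A.Infinite) (c : ℕ → ι) (x : ℕ → X) :
    ∃ i ∈ A, ∃ j ∈ A, i < j ∧ c i = c j ∧ x i ≤ x j := by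
  obtain ⟨d, hd⟩ : ∃ d, (A ∩ c ⁻¹' {d}).Infinite := by
    by_contra! h
    refine hA ((Set.finite_iUnion fun d => h d).subset fun i hi => ?_)
    exact Set.mem_iUnion.2 ⟨c i, hi, rfl⟩
  obtain ⟨i, j, hij, hx⟩ := wellQuasiOrdered_le fun t => x (Nat.nth (· ∈ A ∩ c ⁻¹' {d}) t)
  have hi := Nat.nth_mem_of_infinite hd i
  have hj := Nat.nth_mem_of_infinite hd j
  exact ⟨_, hi.1, _, hj.1, Nat.nth_strictMono hd hij, hi.2.trans hj.2.symm, hx⟩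

/-- Transitivity for the differences `m - u`, cross-added because exponents have no subtraction. -/
lemma ratio_lt_of_le_of_lt {M : Type*} [AddCommMonoid M] [PartialOrder M]
    [IsOrderedCancelAddMonoid M] {us ms uj mj uk mk : M}
    (h1 : us + mj ≤ uj + ms) (h2 : uj + mk < uk + mj) : us + mk < uk + ms := by
  have h := add_lt_add_of_le_of_lt h1 h2
  rw [show us + mj + (uj + mk) = (uj + mj) + (us + mk) by abel,
    show uj + ms + (uk + mj) = (uj + mj) + (uk + ms) by abel] at h
  exact lt_of_add_lt_add_left h

/-- The combinatorial core of termination. The quotients `μ k / u k` take finitely many values by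
Dickson's lemma and grow strictly from an element to its parent, and an element has finitely many
children, again by Dickson's lemma. -/
lemma finite_of_ratio (m : MonomialOrder (Fin n)) (c : ℕ → Fin r) (u μ : ℕ → Fin n →₀ ℕ)
    (N : Set ℕ)
    (hdom : ∀ s k, s < k → r ≤ k → s ∈ N → k ∈ N → c s = c k → u s ≤ u k → μ s ≤ μ k →
      u k + μ s = u s + μ k)
    (hpar : ∀ k ∈ N, r ≤ k → ∃ j < k, j ∈ N ∧ c j = c k ∧ u j + μ k ≺[m] u k + μ j ∧
      ∀ i, j < i → i < k → ¬ (c i = c k ∧ u i ≤ u k)) :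
    N.Finite := by
  classical
  let F₀ : Set ℕ := {k | k ∈ N ∧ ∀ j ∈ N, j < k → ¬ (c j = c k ∧ u j ≤ u k ∧ μ j ≤ μ k)}
  have hF₀ : F₀.Finite := by
    by_contra hF
    obtain ⟨i, hi, j, hj, hij, hc, hx⟩ := exists_lt_le_of_infinite hF c fun k => (u k, μ k)
    exact hj.2 i hi.1 hij ⟨hc, hx.1, hx.2⟩
  have hrep₀ : ∀ k ∈ N, ∃ s ∈ F₀, s ≤ k ∧ c s = c k ∧ u s ≤ u k ∧ μ s ≤ μ k := by
    intro k
    induction k using Nat.strong_induction_on with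
    | _ k ih =>
    intro hk
    by_cases hkF : k ∈ F₀
    · exact ⟨k, hkF, le_rfl, rfl, le_rfl, le_rfl⟩
    · have : ∃ j ∈ N, j < k ∧ (c j = c k ∧ u j ≤ u k ∧ μ j ≤ μ k) := by
        by_contra! h
        exact hkF ⟨hk, fun j hj hjk ⟨h1, h2, h3⟩ => h j hj hjk h1 h2 h3⟩
      obtain ⟨j, hj, hjk, h1, h2, h3⟩ := this
      obtain ⟨s, hs, hsj, h4, h5, h6⟩ := ih j hjk hj
      exact ⟨s, hs, hsj.trans hjk.le, h4.trans h1, h5.trans h2, h6.trans h3⟩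
  -- The positions below `r` represent themselves, since `hdom` says nothing about them as the later
  -- element.
  let F : Finset ℕ := hF₀.toFinset ∪ Finset.range r
  have hrep : ∀ k ∈ N, ∃ s ∈ F, u k + μ s = u s + μ k := by
    intro k hk
    by_cases hkr : k < r
    · exact ⟨k, Finset.mem_union_right _ (Finset.mem_range.2 hkr), rfl⟩
    · obtain ⟨s, hs, hsk, h1, h2, h3⟩ := hrep₀ k hk
      refine ⟨s, Finset.mem_union_left _ (hF₀.mem_toFinset.2 hs), ?_⟩
      rcases hsk.eq_or_lt with rfl | hsk
      · rfl
      · exact hdom s k hsk (not_lt.1 hkr) hs.1 hk h1 h2 h3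
  -- The number of representatives of larger ratio: a depth that increases from parent to child and
  -- is bounded by `F.card`.
  let h : ℕ → ℕ := fun k => (F.filter fun s => u s + μ k ≺[m] u k + μ s).card
  have hlt : ∀ j ∈ N, ∀ k, u j + μ k ≺[m] u k + μ j → h j < h k := by
    intro j hj k hjk
    obtain ⟨s, hs, he⟩ := hrep j hj
    have htrans : ∀ t, u t + μ j ≼[m] u j + μ t → u t + μ k ≺[m] u k + μ t := by
      intro t ht
      simp only [map_add] at *
      exact ratio_lt_of_le_of_lt ht hjk
    -- The representative `s` of `j` is counted for `k` but not for `j`.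
    refine Finset.card_lt_card (Finset.ssubset_iff_of_subset ?_ |>.2 ⟨s, ?_, ?_⟩)
    · exact Finset.monotone_filter_right _ fun t _ ht => htrans t ht.le
    · exact Finset.mem_filter.2 ⟨hs, htrans s (by rw [he])⟩
    · exact fun ht => (Finset.mem_filter.1 ht).2.ne (by rw [he])
  -- Of two children with dividing signatures the earlier one would lie between `j` and the later
  -- one.
  have hchild : ∀ j, {k | j < k ∧ ∀ i, j < i → i < k → ¬ (c i = c k ∧ u i ≤ u k)}.Finite := by
    intro j
    by_contra hinf
    obtain ⟨i, hi, k, hk, hik, hc, hu⟩ := exists_lt_le_of_infinite hinf c u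
    exact hk.2 i hi.1 hik ⟨hc, hu⟩
  have hfin : ∀ d, {k | k ∈ N ∧ h k < d}.Finite := by
    intro d
    induction d with
    | zero => simp
    | succ d ih =>
      refine ((Set.finite_Iio r).union (ih.biUnion fun j _ => hchild j)).subset ?_
      rintro k ⟨hk, hkd⟩
      by_cases hkr : k < r
      · exact .inl hkr
      · obtain ⟨j, hjk, hj, -, h1, h2⟩ := hpar k hk (not_lt.1 hkr)
        have := hlt j hj k h1
        exact .inr (Set.mem_biUnion (x := j) ⟨hj, by omega⟩ ⟨hjk, h2⟩)
  exact (hfin (F.card + 1)).subset fun k hk =>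
    ⟨hk, Nat.lt_succ_of_le (Finset.card_le_card (Finset.filter_subset _ _))⟩

end Dickson

variable {K : Type*} [Field K] {n r : ℕ} {m : MonomialOrder (Fin n)}
  {f : Fin r → MvPolynomial (Fin n) K}

lemma not_forall_insertedAfter (g : ℕ → SigPoly K n r) (hg : ∀ k, Valid m f (g k)) :
    ¬ ∀ k, r ≤ k → InsertedAfter m f ((List.range k).map g) (g k) := by
  intro hins
  have hget : ∀ {k j : ℕ}, j < k → ((List.range k).map g)[j]? = some (g j) := by
    intro k j hj
    simp [List.getElem?_range hj]
  have hZ : {k | r ≤ k ∧ (g k).poly = 0}.Finite := by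
    by_contra hinf
    obtain ⟨i, hi, j, hj, hij, hc, hu⟩ := exists_lt_le_of_infinite hinf
      (fun k => (g k).sig.1) fun k => (g k).sig.2
    exact (hins j hj.1).not_divides (g i) (List.mem_of_getElem? (hget hij)) hi.2
      (Signature.divides_iff.2 ⟨hc, hu⟩)
  have hN : {k | (g k).poly ≠ 0}.Finite := by
    refine finite_of_ratio m (fun k => (g k).sig.1) (fun k => (g k).sig.2)
      (fun k => m.degree (g k).poly) _ ?_ ?_
    · intro s k hsk hrk hs hk hc hu hμ
      have hnot := (hins k hrk).not_sigLM hk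
      obtain ⟨a, ha⟩ := Signature.divides_iff.2 ⟨hc, hu⟩
      obtain ⟨b, hb⟩ := exists_add_of_le hμ
      rw [add_comm] at hb
      have h1 := (hg s).hasSig.monomial_mul (a := a) (one_ne_zero (α := K))
      rw [ha] at h1
      have h2 := ((hg k).hasSig.degree_le_of_not_sigLM hk hnot h1).2
      rw [degree_monomial_mul one_ne_zero hs, hb, map_add, map_add, add_le_add_iff_right] at h2
      -- Minimality at the signature of `g k` gives `b ≼ a`; if `b ≺ a`, then `b` times `g s` would
      -- show the leading monomial of `g k` at a smaller signature.
      have hab : a = b := by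
        refine (m.toSyn.injective (h2.antisymm (not_lt.1 fun h3 => ?_))).symm
        refine hnot ⟨monomial b 1 * (g s).poly, ?_, mul_ne_zero (by simp) hs, ?_⟩
        · refine ((hg s).hasSig.monomial_mul one_ne_zero).sigLT ?_
          rw [← ha]
          exact .inr ⟨rfl, by simpa using h3⟩
        · rw [degree_monomial_mul one_ne_zero hs, hb]
      rw [hb, ← ha, hab, Signature.mul_snd]
      abel
    · intro k hk hrk
      have hnot := (hins k hrk).not_sigLM hk
      obtain ⟨j, α, a, hj, hs, hlast, hα, hlm⟩ := (hins k hrk).parent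
      have hjk : j < k := by
        simpa using (List.getElem?_eq_some_iff.1 hj).1
      obtain rfl : g j = α := by simpa using (hget hjk).symm.trans hj
      have h1 := (hg j).hasSig.monomial_mul (a := a) (one_ne_zero (α := K))
      rw [hs] at h1
      have h2 := ((hg k).hasSig.degree_le_of_not_sigLM hk hnot h1).2
      rw [degree_monomial_mul one_ne_zero hα] at h2
      -- Equality is excluded because the leading monomial of the parent's multiple occurs below the
      -- signature of `g k`, and that of `g k` does not.
      have h3 : m.degree (g k).poly ≺[m] a + m.degree (g j).poly :=
        lt_of_le_of_ne h2 fun h => hnot (m.toSyn.injective h ▸ hlm)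
      refine ⟨j, hjk, hα, ?_, ?_, fun i hji hik hd => ?_⟩
      · rw [← hs, Signature.mul_fst]
      · rw [← hs, Signature.mul_snd, add_right_comm, add_comm, map_add,
          map_add m.toSyn (a + _)]
        exact add_lt_add_left h3 _
      · exact hlast i (g i) hji (hget hik) (Signature.divides_iff.2 hd)
  refine Set.infinite_univ ((hZ.union (hN.union (Set.finite_Iio r))).subset fun k _ => ?_)
  by_cases hr : k < r
  · exact .inr (.inr hr)
  · by_cases h0 : (g k).poly = 0
    · exact .inl ⟨not_lt.1 hr, h0⟩
    · exact .inr (.inl h0)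

/-- The list `G` of a state. -/
def State.list : State K n r → List (SigPoly K n r)
  | .main v => v.G
  | .reducing v _ => v.G

open Classical in
/-- A quantity that decreases in the steps that do not change the list `G`. -/
noncomputable def State.rank (m : MonomialOrder (Fin n)) : State K n r → ℕ ×ₗ WithBot m.syn
  | .main v => toLex (v.P.ncard + 1, ⊥)
  | .reducing _ γ => toLex (0, if γ.poly = 0 then ⊥ else (m.toSyn (m.degree γ.poly) : m.syn))

variable {s s' : State K n r}

lemma Step.list_prefix (h : Step m s s') : s.list <+: s'.list := by
  cases h <;> simp [State.list]

lemma StateInv.rank_lt (h : StateInv m f s) (hs : Step m s s')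
    (hl : s'.list.length ≤ s.list.length) : s'.rank m < s.rank m := by
  cases hs with
  | discard v k l α β hmin hrw =>
    have hv : Inv m f v := h
    refine Prod.Lex.toLex_lt_toLex.2 (.inl (Nat.succ_lt_succ ?_))
    exact Set.ncard_sdiff_singleton_lt_of_mem hmin.1 hv.finite
  -- The `+ 1` in the rank at the main loop is needed here, when the last pair is taken.
  | select v k l α β hmin hrw => exact Prod.Lex.toLex_lt_toLex.2 (.inl (Nat.succ_pos _))
  | reduce v γ γ' hred =>
    obtain ⟨h0, h1⟩ := hred.degree_lt
    refine Prod.Lex.toLex_lt_toLex.2 (.inr ⟨rfl, ?_⟩)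
    dsimp only
    rw [if_neg h0]
    split_ifs with h2
    · exact WithBot.bot_lt_coe _
    · exact WithBot.coe_lt_coe.2 (h1.resolve_left h2)
  | insert v γ hirr hγ => simp [State.list] at hl
  | record v γ hγ => simp [State.list] at hl

lemma StateInv.valid (h : StateInv m f s) : ∀ δ ∈ s.list, Valid m f δ := by
  rcases s with v | ⟨v, γ⟩
  · exact Inv.valid h
  · obtain ⟨v₀, k, l, α, β, rfl, hv, -⟩ := h
    exact hv.valid

lemma StateInv.inserted (h : StateInv m f s) :
    ∀ k γ, r ≤ k → s.list[k]? = some γ → InsertedAfter m f (s.list.take k) γ := by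
  rcases s with v | ⟨v, γ⟩
  · exact Inv.inserted h
  · obtain ⟨v₀, k, l, α, β, rfl, hv, -⟩ := h
    exact hv.inserted

/-- There is no infinite run. -/
lemma not_exists_run : ¬ ∃ run : ℕ → State K n r,
    run 0 = init m f ∧ ∀ t, Step m (run t) (run (t + 1)) := by
  rintro ⟨run, h0, hstep⟩
  have hinv : ∀ t, StateInv m f (run t) := by
    intro t
    refine Reachable.stateInv ?_
    induction t with
    | zero => exact h0 ▸ .refl
    | succ t ih => exact .tail ih (hstep t)
  have hpre : ∀ t i, (run t).list <+: (run (t + i)).list := by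
    intro t i
    induction i with
    | zero => exact List.prefix_rfl
    | succ i ih => exact ih.trans (hstep _).list_prefix
  have hgrow : ∀ t, ∃ i, (run t).list.length < (run (t + i)).list.length := by
    intro t
    by_contra! hle
    obtain ⟨i, hi⟩ := WellFounded.not_rel_apply_succ (r := (· < ·))
      fun i => (run (t + i)).rank m
    exact hi ((hinv _).rank_lt (hstep _) ((hle (i + 1)).trans (hpre t i).length_le))
  have hlong : ∀ k, ∃ t, k < (run t).list.length := by
    intro k
    induction k with
    | zero =>
      obtain ⟨i, hi⟩ := hgrow 0
      exact ⟨_, (Nat.zero_le _).trans_lt hi⟩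
    | succ k ih =>
      obtain ⟨t, ht⟩ := ih
      obtain ⟨i, hi⟩ := hgrow t
      exact ⟨_, Nat.lt_of_le_of_lt ht hi⟩
  choose T hT using hlong
  -- The lists are prefixes of one another, so their entries form one infinite sequence.
  let g : ℕ → SigPoly K n r := fun k => (run (T k)).list[k]'(hT k)
  have hpre' : ∀ {t t'}, t ≤ t' → (run t).list <+: (run t').list := by
    intro t t' h
    obtain ⟨i, rfl⟩ := Nat.exists_eq_add_of_le h
    exact hpre t i
  have hg : ∀ t k, k < (run t).list.length → (run t).list[k]? = some (g k) := by
    intro t k hk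
    have hgk : (run (T k)).list[k]? = some (g k) := List.getElem?_eq_getElem (hT k)
    rcases le_total t (T k) with h | h
    · obtain ⟨L, hL⟩ := hpre' h
      rwa [← hL, List.getElem?_append_left hk] at hgk
    · obtain ⟨L, hL⟩ := hpre' h
      rwa [← hL, List.getElem?_append_left (hT k)]
  refine not_forall_insertedAfter (m := m) (f := f) g (fun k => ?_) fun k hk => ?_
  · exact (hinv (T k)).valid _ (List.getElem_mem _)
  · have := (hinv (T k)).inserted k (g k) hk (hg _ _ (hT k))
    convert this using 1
    refine List.ext_getElem? fun j => ?_
    by_cases hj : j < k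
    · rw [List.getElem?_take_of_lt hj, hg _ _ (hj.trans (hT k))]
      simp [List.getElem?_range hj]
    · rw [List.getElem?_eq_none (by simpa using hj),
        List.getElem?_eq_none (by simp; omega)]

end SGB

/-! ### The output: Gröbner basis, colon ideals and new quotients. -/

namespace SGB

open MvPolynomial

variable {K : Type*} [Field K] {n r : ℕ} {m : MonomialOrder (Fin n)}
  {f : Fin r → MvPolynomial (Fin n) K} {v : Vars K n r} {γ : SigPoly K n r}

lemma IsComplete.isGroebnerBasis {G : List (SigPoly K n r)}
    (h : IsComplete m f G fun _ => True) :
    IsGroebnerBasis m (Ideal.span (Set.range f)) (polys G) := by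
  have hsub : polys G ⊆ Ideal.span (Set.range f) := by
    rintro _ ⟨α, hα, rfl⟩
    exact (h.valid α hα).mem_span
  refine ⟨?_, hsub, le_antisymm ?_ ?_⟩
  · refine (G.finite_toSet.image SigPoly.poly).subset ?_
    rintro _ ⟨α, hα, rfl⟩
    exact ⟨α, hα, rfl⟩
  · refine Ideal.span_mono ?_
    rintro _ ⟨p, hp, h0, rfl⟩
    exact ⟨p, hsub hp, h0, rfl⟩
  · refine Ideal.span_le.2 ?_
    rintro _ ⟨p, hp, h0, rfl⟩
    obtain ⟨ρ, hρ⟩ := exists_hasSig_of_mem_span_range (m := m) h0 hp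
    obtain ⟨β, hβ, b, hβ0, hb, -⟩ := h.exists_reducer hρ h0 trivial
    have h1 : monomial (m.degree β.poly) (1 : K) ∈ leadIdeal m (polys G) :=
      Ideal.subset_span ⟨_, ⟨β, hβ, rfl⟩, hβ0, rfl⟩
    have h2 := Ideal.mul_mem_left _ (monomial b (1 : K)) h1
    rwa [monomial_mul, one_mul, hb] at h2

/-- An ideal `J` contained in `I` equals `I` if every leading monomial of `I` is divisible by one
of `J`. -/
lemma eq_of_forall_exists_degree_le {I J : Ideal (MvPolynomial (Fin n) K)} (hJI : J ≤ I)
    (h : ∀ g ∈ I, g ≠ 0 → ∃ p ∈ J, p ≠ 0 ∧ m.degree p ≤ m.degree g) : J = I := by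
  refine le_antisymm hJI fun g => ?_
  induction hd : m.toSyn (m.degree g) using WellFoundedLT.induction generalizing g with
  | _ d ih =>
  intro hg
  by_cases hg0 : g = 0
  · exact hg0 ▸ J.zero_mem
  obtain ⟨p, hp, hp0, hle⟩ := h g hg hg0
  set p' := monomial (m.degree g - m.degree p) (1 : K) * p with hp'
  have hpJ : p' ∈ J := Ideal.mul_mem_left _ _ hp
  have hdeg : m.degree p' = m.degree g := by
    rw [hp', degree_monomial_mul one_ne_zero hp0, tsub_add_cancel_of_le hle]
  set c := C (m.leadingCoeff g / m.leadingCoeff p') with hc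
  have hcJ : c * p' ∈ J := Ideal.mul_mem_left _ _ hpJ
  rcases degree_sub_C_mul_lt (m := m) (mul_ne_zero (by simp) hp0 : p' ≠ 0) hdeg.symm with h0 | hlt
  · rwa [sub_eq_zero.1 h0]
  · have := ih _ (hd ▸ hlt) _ rfl (sub_mem hg (hJI hcJ))
    simpa using add_mem this hcJ

/-- A nonzero `g` in the colon ideal makes `(i, lm(g))` a syzygy signature; its witness is a
recorded quotient or an element of the ideal of smaller indices, with leading monomial dividing
`lm(g)`. -/
lemma Inv.colon_eq (hv : Inv m f v) (h : IsComplete m f v.G fun _ => True) {i : Fin r}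
    (hi : f i ≠ 0) : idealBelow f i ⊔ Ideal.span (v.S i) = (idealBelow f i).colon {f i} := by
  refine eq_of_forall_exists_degree_le (m := m) (sup_le (fun p hp => ?_) ?_) fun g hg hg0 => ?_
  · exact Submodule.mem_colon_singleton.2 (Ideal.mul_mem_right _ _ hp)
  · refine Ideal.span_le.2 fun q hq => Submodule.mem_colon_singleton.2 ?_
    obtain ⟨δ, hδ, h0, rfl, rfl⟩ := hv.exists_of_mem_S i q hq
    have := (hv.valid δ hδ).2.2
    rwa [h0, zero_sub, neg_mem_iff] at this
  · have hs : HasSig m f (i, m.degree g) 0 := by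
      refine ⟨g, hg0, rfl, ?_⟩
      rw [zero_sub, neg_mem_iff]
      exact Submodule.mem_colon_singleton.1 hg
    rcases h.syzWitness hs trivial with ⟨δ, hδ, h0, hd⟩ | ⟨δ, hδ, h1, h2, h3⟩
    · obtain ⟨h1, h2⟩ := Signature.divides_iff.1 hd
      have hval := hv.valid δ hδ
      obtain ⟨k, hk⟩ := List.mem_iff_getElem?.1 hδ
      refine ⟨δ.quo, Ideal.mem_sup_right (Ideal.subset_span ?_), hval.1, hval.2.1 ▸ h2⟩
      -- Quotients of initial elements are never recorded; `f i ≠ 0` excludes such a witness.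
      have hrk : r ≤ k := by
        by_contra! hkr
        have hinit := hv.initial ⟨k, hkr⟩
        obtain rfl := Option.some_injective _ (hinit.symm.trans hk)
        dsimp only at h0 h1
        exact hi (h1 ▸ h0)
      have hmem := hv.mem_S k δ hrk hk h0
      rwa [show δ.ind = i from h1] at hmem
    · exact ⟨δ.poly, Ideal.mem_sup_left ((hv.valid δ hδ).mem_idealBelow h1), h2, h3⟩

/-- The quotients recorded by the algorithm are new. -/
lemma RInv.quo_new (h : RInv m f v γ) (hγ : γ.poly = 0) :
    γ.quo ≠ 0 ∧ (∀ p ∈ idealBelow f γ.ind, p ≠ 0 → ¬ m.degree p ≤ m.degree γ.quo) ∧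
      ∀ q ∈ v.S γ.ind, ¬ m.degree q ≤ m.degree γ.quo := by
  have hins := h.insertedAfter fun γ' => not_regRedStep_of_poly_eq_zero hγ
  obtain ⟨j, α, a, hj, hs, hrw, -⟩ := h.exists_parent
  have hc := h.isComplete
  obtain ⟨v₀, k₀, l₀, α₀, β₀, rfl, hv, -, -, hval, -⟩ := h
  dsimp only at *
  refine ⟨hval.1, fun p hp hp0 hle => ?_, fun q hq hle => ?_⟩
  -- The signature of `p` has a smaller index, so `G` already contains a reducer of `p`, and this
  -- would trigger the Koszul criterion on the parent's multiple.
  · obtain ⟨ρ, hρ, hpρ⟩ := exists_hasSig_of_mem_idealBelow (m := m) hp0 hp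
    obtain ⟨β, hβ, b, hβ0, hb, hlt⟩ := hc.exists_reducer hpρ hp0 (.inl hρ)
    obtain ⟨i, hi⟩ := List.mem_iff_getElem?.1 hβ
    refine hrw ⟨i, β, hi, .inr (.inr ⟨?_, hβ0, ?_⟩)⟩
    · have h1 : ¬ ρ.1 < β.sig.1 := fun h1 => hlt (.inl h1)
      have h2 : α.ind = γ.ind := by rw [SigPoly.ind, SigPoly.ind, ← hs, Signature.mul_fst]
      rw [h2]
      exact (not_lt.1 h1).trans_lt hρ
    · rw [(hc.valid α (List.mem_of_getElem? hj)).degree_monomial_mul_quo]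
      have h2 : a + α.sig.2 = γ.sig.2 := by rw [← hs, Signature.mul_snd]
      rw [h2, ← hval.2.1]
      exact le_trans (hb ▸ le_add_self) hle
  · obtain ⟨δ, hδ, h0, h1, rfl⟩ := hv.exists_of_mem_S _ q hq
    refine hins.not_divides δ hδ h0 (Signature.divides_iff.2 ⟨h1, ?_⟩)
    rwa [← (hv.valid δ hδ).2.1, ← hval.2.1]

lemma Inv.isComplete_of_empty (h : Inv m f v) (hP : v.P = ∅) :
    IsComplete m f v.G fun _ => True :=
  h.isComplete (fun _ _ _ _ => trivial) fun _ _ _ _ hp => by simp [hP] at hp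

end SGB

theorem mainTheorem3 {K : Type*} [Field K] {n r : ℕ} (m : MonomialOrder (Fin n))
    (f : Fin r → MvPolynomial (Fin n) K) :
    -- termination, whatever choices are made: no infinite run, and a run can only stop
    -- at the head of the main loop with an empty set of pairs
    ((¬ ∃ run : ℕ → SGB.State K n r,
        run 0 = SGB.init m f ∧ ∀ t, SGB.Step m (run t) (run (t + 1))) ∧
      ∀ s : SGB.State K n r, SGB.Reachable m f s → (∀ s', ¬ SGB.Step m s s') →
        ∃ v : SGB.Vars K n r, s = SGB.State.main v ∧ v.P = ∅) ∧
    -- the output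
    (∀ v : SGB.Vars K n r, SGB.Reachable m f (SGB.State.main v) → v.P = ∅ →
      SGB.IsGroebnerBasis m (Ideal.span (Set.range f)) (SGB.polys v.G) ∧
      ∀ i : Fin r, f i ≠ 0 →
        SGB.idealBelow f i ⊔ Ideal.span (v.S i) = (SGB.idealBelow f i).colon {f i}) ∧
    -- whenever the regular reduction ends with zero, so that `γ.quo` is about to be inserted
    -- in `v.S γ.ind`
    (∀ (v : SGB.Vars K n r) (γ : SGB.SigPoly K n r),
      SGB.Reachable m f (SGB.State.reducing v γ) → γ.poly = 0 →
        γ.quo ≠ 0 ∧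
        (∀ p ∈ SGB.idealBelow f γ.ind, p ≠ 0 → ¬ m.degree p ≤ m.degree γ.quo) ∧
        ∀ h ∈ v.S γ.ind, ¬ m.degree h ≤ m.degree γ.quo) := by
  refine ⟨⟨SGB.not_exists_run, fun s hs => hs.stateInv.eq_main_of_final⟩, fun v hv hP => ?_,
    fun v γ h hγ => ?_⟩
  · have hinv : SGB.Inv m f v := hv.stateInv
    have hc := hinv.isComplete_of_empty hP
    exact ⟨hc.isGroebnerBasis, fun i hi => hinv.colon_eq hc hi⟩
  · have hinv : SGB.RInv m f v γ := h.stateInv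
    exact hinv.quo_new hγ
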